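/- Let $f(t,x)\in\mathbb Z[t,x]$ be monic in $x$ of degree $n>2$ in $x$, and separable as a polynomial in $x$ over $\mathbb Q(t)$. Let $f'$ be the derivative of $f$ with respect to $x$, and let $\underline{f}'(t,y)\in\mathbb Z[t,y]$ be the polynomial, monic in $y$, with $\underline{f}'(t,nx)=n^{n-2}f'(t,x)$. Let $D$ denote the discriminant with respect to $x$ (respectively $y$). An arithmetic progression is a set $\{a+bk : k\in\mathbb Z\}$ with $a,b\in\mathbb Z$, $b\neq 0$. For $c\in\mathbb Z$ let $K_c$ be the splitting field of $f(c,x)$ over $\mathbb Q$, inside a fixed algebraic closure of $\mathbb Q$. 1. Assume that (i) the greatest common divisor in $\mathbb Z[t]$ of $D(f(t,x))$ and $(n-1)n\,D(\underline{f}'(t,x))$ is a constant $N\in\mathbb Z$, and (ii) there exists $c\in\mathbb Z$ such that every prime dividing both $D(f(c,x))$ and $(n-1)n\,D(\underline{f}'(c,x))$ divides $N$. Then there exists an arithmetic progression such that for every $c$ in it, all inertia groups in $\mathrm{Gal}(K_c/\mathbb Q)$ at primes not dividing $N$ have order at most $2$. In particular, when $N=1$, all inertia groups in $\mathrm{Gal}(K_c/\mathbb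 Q)$ at all primes have order at most $2$. 2. Let $N\in\mathbb Z$ and let $P$ be an arithmetic progression such that for every $c\in P$ all inertia groups in $\mathrm{Gal}(K_c/\mathbb Q)$ at primes not dividing $N$ have order at most $2$ (for instance $N$ and $P$ as in part 1). Assume further that (iii) $f(t,x)$ is irreducible in $\mathbb Q[t,x]$ with Galois group $G$ over $\mathbb Q(t)$, and (iv) the splitting field of $f(t,x)$ over $\mathbb Q(t)$ is regular over $\mathbb Q$, i.e. $\mathbb Q$ is algebraically closed in it. Then there exists an infinite set $S\subseteq P$ such that for every $c\in S$ the group $\mathrm{Gal}(K_c/\mathbb Q)$ is isomorphic to $G$ and all its inertia groups at primes not dividing $N$ have order at most $2$, and such that the fields $K_c$ $(c\in S)$ are linearly disjoint over $\mathbb Q$: each $K_c$ is linearly disjoint over $\mathbb Q$ from the compositum of all the other $K_{c'}$, $c'\in S$. -/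

import Mathlib

open Polynomial

noncomputable section

/-! A polynomial `f(t, x)` with integer coefficients is an element of `ℤ[X][X]`: the inner variable
is `t`, the outer variable is `x`. -/

/-- `d` is a greatest common divisor of `a` and `b`. -/
def IsGCDOf {R : Type*} [CommRing R] (d a b : R) : Prop :=
  d ∣ a ∧ d ∣ b ∧ ∀ e : R, e ∣ a → e ∣ b → e ∣ d

/-- The specialization `f(c, x)`. -/
def specialize (f : ℤ[X][X]) (c : ℤ) : ℤ[X] := f.map (evalRingHom c)

/-- `f` as an element of `ℚ[t, x]`. -/
def overRat (f : ℤ[X][X]) : ℚ[X][X] := f.map (mapRingHom (Int.castRingHom ℚ))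

/-- `f` as a polynomial in `x` over the rational function field `ℚ(t)`. -/
def overRatFunc (f : ℤ[X][X]) : (RatFunc ℚ)[X] := (overRat f).map (algebraMap ℚ[X] (RatFunc ℚ))

/-- For `f` monic of degree `n` in `x`, this is the monic polynomial `h(t, y)` with
`h(t, n x) = n ^ (n - 2) f'(t, x)`, where `f'` is the derivative in `x`;
see `normalizedDerivative_comp`. -/
def normalizedDerivative (f : ℤ[X][X]) : ℤ[X][X] := (derivative f).integralNormalization

theorem normalizedDerivative_comp (f : ℤ[X][X]) (n : ℕ) (hn : 2 < n) (hf : f.Monic)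
    (hd : f.natDegree = n) :
    (normalizedDerivative f).comp (C (n : ℤ[X]) * X) = C ((n : ℤ[X]) ^ (n - 2)) * derivative f := by
  have hnd : (derivative f).natDegree = n - 1 := by rw [natDegree_derivative, hd]
  have hlc : (derivative f).leadingCoeff = (n : ℤ[X]) := by
    rw [leadingCoeff, hnd, coeff_derivative]
    have h1 : n - 1 + 1 = n := by omega
    have h2 : f.coeff n = 1 := by rw [← hd]; exact hf
    rw [h1, h2, one_mul]
    have : ((n - 1 : ℕ) : ℤ[X]) + 1 = ((n - 1 + 1 : ℕ) : ℤ[X]) := by push_cast; ring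
    rw [this, h1]
  have h0 : derivative f ≠ 0 := by
    intro h
    rw [h] at hnd
    simp at hnd
    omega
  ext1 i
  rw [comp_C_mul_X_coeff, coeff_C_mul, normalizedDerivative, integralNormalization_coeff, hlc, hnd]
  split_ifs with h
  · have hi : i = n - 1 := by
      rw [← hnd]; exact (natDegree_eq_of_degree_eq_some h).symm
    have : (derivative f).coeff i = (n : ℤ[X]) := by rw [hi, ← hnd]; exact hlc
    rw [this, hi, one_mul, ← pow_succ]
    congr 1
    omega
  · by_cases hi : i ≤ n - 2
    · rw [mul_assoc, ← pow_add, mul_comm]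
      congr 2
      omega
    · have hlt : (derivative f).natDegree < i := by
        rcases Nat.lt_or_ge (n - 1) i with h' | h'
        · omega
        · exact absurd (by rw [degree_eq_natDegree h0, hnd]; congr 1; omega) h
      rw [coeff_eq_zero_of_natDegree_lt hlt]
      simp

/-- The splitting field of `g ∈ ℤ[x]` over `ℚ`, inside a fixed algebraic closure of `ℚ`. -/
def splittingFieldRat (g : ℤ[X]) : IntermediateField ℚ (AlgebraicClosure ℚ) :=
  IntermediateField.adjoin ℚ (g.rootSet (AlgebraicClosure ℚ))

/-- In the Galois group of the splitting field `K` of `g` over `ℚ`, the inertia group of every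
prime of `𝓞 K` above the rational prime `p` has order at most two. -/
def InertiaOrderLeTwoAt (g : ℤ[X]) (p : ℕ) : Prop :=
  ∀ P : Ideal (NumberField.RingOfIntegers (splittingFieldRat g)), P.IsPrime →
    P.LiesOver (Ideal.span {(p : ℤ)}) →
    Nat.card (P.inertia (splittingFieldRat g ≃ₐ[ℚ] splittingFieldRat g)) ≤ 2

/-- All inertia groups of the splitting field of `g` at primes not dividing `N` have order
at most two. -/
def InertiaOrderLeTwoAwayFrom (g : ℤ[X]) (N : ℤ) : Prop :=
  ∀ p : ℕ, p.Prime → ¬ (p : ℤ) ∣ N → InertiaOrderLeTwoAt g p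

/-- An extension `L` of `ℚ` is regular (characteristic zero): `ℚ` is algebraically closed in `L`. -/
def IsRegularOverRat (L : Type*) [Field L] [Algebra ℚ L] : Prop := algebraicClosure ℚ L = ⊥

/-- A family of subfields of the algebraic closure of `ℚ`, indexed by the elements of `S`, is
linearly disjoint over `ℚ`: each member is linearly disjoint from the compositum of the others. -/
def LinearlyDisjointFamily (K : ℤ → IntermediateField ℚ (AlgebraicClosure ℚ)) (S : Set ℤ) : Prop :=
  ∀ c ∈ S, (K c).LinearDisjoint (⨆ c' ∈ S \ {c}, K c' : IntermediateField ℚ (AlgebraicClosure ℚ))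

end

/-! Part 1. Let h be the normalized derivative. The gcd condition makes the discriminants of f and
(n-1)n D(h) coprime over ℚ, so an integral combination of them is a nonzero integer M. On c₀ + Mℤ a
prime dividing both values divides M, hence divides both values at c₀, hence divides N. So a prime p
not dividing N misses one of the two values. If p does not divide D(f(c,x)), the roots are distinct
modulo every P above p and inertia is trivial. Otherwise p is odd, since n(n-1) is even, and p
divides neither n nor D(h(c,y)). An inertia element σ with σ² ≠ 1 would give three distinct roots α,
σα, σ²α congruent modulo P, hence a common zero nα of h and its derivative modulo P, forcing p ∣
D(h(c,y)). So inertia has exponent two; away from 2 such a group acts faithfully by signs on a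
uniformizer modulo P², hence has order at most 2 (`card_inertia_le_two`).

Part 2 rests on Hilbert irreducibility, proved from scratch. Suppose finitely many monic separable
curves have an integral point above every natural number. Above r + pj, with p a large prime, many
of these points share a curve and a residue modulo p. By Hensel their ordinates are modulo p^m a
polynomial in j of degree less than m. An integral Lagrange relation among them is then divisible by
p^m, yet smaller than p^m by polynomial growth, so it vanishes. The points lie on the graph of one
polynomial, which satisfies the curve equation identically
(`exists_polynomial_root_of_forall_exists_root`).

For Galois groups, t ↦ c is extended to the ring generated by the generic roots. Gal(K_c/ℚ) is then
the image of a decomposition group; a proper decomposition group would produce an integral point on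
one of finitely many auxiliary curves, and inertia is trivial for almost all c
(`exists_card_gal_specialize_eq`).

Linear disjointness comes from applying this to f·l, where l is the product of the specializations
already chosen. Regularity keeps the splitting field of f over ℚ(t) independent of the constant
extension cut out by l, so c can be chosen to multiply the degree of the compositum by |G|. As no
K_c has degree above |G|, all degree inequalities become equalities, which is linear disjointness.
-/

noncomputable section

/-! ### Formal branches of plane curves modulo prime powers -/

theorem eval_specialize (h : ℤ[X][X]) (c y : ℤ) :
    (specialize h c).eval y = (h.eval (C y)).eval c := by
  rw [specialize, ← coe_evalRingHom c, ← eval₂_hom, ← eval_map]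
  simp

theorem derivative_specialize (h : ℤ[X][X]) (c : ℤ) :
    derivative (specialize h c) = specialize (derivative h) c := by
  rw [specialize, specialize, derivative_map]

/-- Hensel's lemma with a parameter: near a simple point of a plane curve, modulo a nilpotent `p`,
the ordinate of a point with abscissa `r + p j` is a polynomial in `p j`. -/
theorem exists_polynomial_branch_of_nilpotent {Z : Type*} [CommRing Z] [Nontrivial Z] {p : ℤ}
    {m : ℕ} (hp : (p : Z) ^ m = 0) (h : ℤ[X][X]) (r y₀ : ℤ)
    (h0 : IsNilpotent (((specialize h r).eval y₀ : ℤ) : Z))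
    (h1 : IsUnit (((specialize (derivative h) r).eval y₀ : ℤ) : Z)) :
    ∃ g : Z[X], g.degree < m ∧ ∀ j z : ℤ, (specialize h (r + p * j)).eval z = 0 →
      IsNilpotent ((y₀ : Z) - z) → (z : Z) = g.eval ((p : Z) * j) := by
  -- Work at the generic nilpotent increment: in Z[ρ]/(ρ^m), the point t = r + ρ still has y₀ as a
  -- simple approximate root, so Newton iteration gives one root φ that serves every j at once.
  obtain ⟨ρ, hρ0⟩ : ∃ ρ : AdjoinRoot ((X : Z[X]) ^ m), ρ = AdjoinRoot.root _ := ⟨_, rfl⟩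
  have hρ : IsNilpotent ρ := ⟨m, by
    have := AdjoinRoot.eval₂_root ((X : Z[X]) ^ m)
    simpa [hρ0] using this⟩
  obtain ⟨ι, hιC, hιX⟩ : ∃ ι : ℤ[X] →+* AdjoinRoot ((X : Z[X]) ^ m),
      (∀ a : ℤ, ι (C a) = (a : AdjoinRoot ((X : Z[X]) ^ m))) ∧ ι X = r + ρ :=
    ⟨eval₂RingHom (Int.castRingHom _) (r + ρ), by simp, by simp⟩
  have hι : ∀ g : ℤ[X], IsNilpotent (ι g - ((g.eval r : ℤ) : AdjoinRoot ((X : Z[X]) ^ m))) := by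
    intro g
    have hd : (X - C r) ∣ g - C (g.eval r) := by
      rw [dvd_iff_isRoot]; simp
    obtain ⟨q, hq⟩ := hd
    have h2 : ι g - ((g.eval r : ℤ) : AdjoinRoot ((X : Z[X]) ^ m)) = ρ * ι q := by
      have := congrArg ι hq
      rw [map_sub, map_mul, map_sub, hιX, hιC, hιC] at this
      rw [this]; ring
    rw [h2]
    exact (Commute.all _ _).isNilpotent_mul_right hρ
  have hPe : ∀ g : ℤ[X][X], (g.map ι).eval (y₀ : AdjoinRoot ((X : Z[X]) ^ m))
      = ι (g.eval (C y₀)) := by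
    intro g
    rw [← hιC, eval_map, eval₂_hom]
  have hcast : ∀ a : ℤ, (a : AdjoinRoot ((X : Z[X]) ^ m)) = AdjoinRoot.of _ (a : Z) := by
    intro a; simp
  have hn : IsNilpotent (aeval (y₀ : AdjoinRoot ((X : Z[X]) ^ m)) (h.map ι)) := by
    rw [coe_aeval_eq_eval, hPe]
    have := hι (h.eval (C y₀))
    rw [← eval_specialize] at this
    have h3 := h0.map (AdjoinRoot.of ((X : Z[X]) ^ m))
    rw [← hcast] at h3
    have := (Commute.all _ _).isNilpotent_add this h3
    rwa [sub_add_cancel] at this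
  have hu : IsUnit (aeval (y₀ : AdjoinRoot ((X : Z[X]) ^ m)) (derivative (h.map ι))) := by
    rw [coe_aeval_eq_eval, derivative_map, hPe]
    have := hι ((derivative h).eval (C y₀))
    rw [← eval_specialize] at this
    have h3 := h1.map (AdjoinRoot.of ((X : Z[X]) ^ m))
    rw [← hcast] at h3
    have := this.isUnit_add_left_of_commute h3 (Commute.all _ _)
    rwa [add_sub_cancel] at this
  obtain ⟨φ, ⟨hφ1, hφ2⟩, -⟩ := existsUnique_nilpotent_sub_and_aeval_eq_zero hn hu
  have hmon : ((X : Z[X]) ^ m).Monic := monic_X_pow m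
  obtain ⟨g₀, rfl⟩ := AdjoinRoot.mk_surjective φ
  have hgd : (g₀ %ₘ X ^ m).degree < m := by
    have := degree_modByMonic_lt g₀ hmon
    rwa [degree_X_pow] at this
  have hgm : AdjoinRoot.mk ((X : Z[X]) ^ m) g₀ = AdjoinRoot.mk _ (g₀ %ₘ X ^ m) := by
    rw [AdjoinRoot.mk_eq_mk]
    exact ⟨g₀ /ₘ X ^ m, by rw [sub_eq_iff_eq_add, add_comm]; exact (modByMonic_add_div _ _).symm⟩
  rw [hgm] at hφ1 hφ2
  refine ⟨_, hgd, fun j z hz hzy => ?_⟩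
  have hpj : eval₂ (RingHom.id Z) ((p : Z) * j) (X ^ m) = 0 := by
    rw [eval₂_pow, eval₂_X, mul_pow, hp, zero_mul]
  obtain ⟨ev, hevr, hev⟩ : ∃ ev : AdjoinRoot ((X : Z[X]) ^ m) →+* Z, ev ρ = (p : Z) * j ∧
      ∀ q : Z[X], ev (AdjoinRoot.mk _ q) = q.eval ((p : Z) * j) :=
    ⟨AdjoinRoot.lift (RingHom.id Z) ((p : Z) * j) hpj, by rw [hρ0, AdjoinRoot.lift_root],
      fun q => by rw [AdjoinRoot.lift_mk, eval₂_id]⟩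
  have hevι : ev.comp ι = (Int.castRingHom Z).comp (evalRingHom (r + p * j)) := by
    apply Polynomial.ringHom_ext
    · intro a; simp
    · simp [hιX, hevr]
  have hy : ev (y₀ : AdjoinRoot ((X : Z[X]) ^ m)) = y₀ := map_intCast ev y₀
  have hn' : IsNilpotent (aeval (y₀ : Z) ((h.map ι).map ev)) := by
    have := hn.map ev
    rw [coe_aeval_eq_eval] at this ⊢
    rwa [eval_map, ← hy, eval₂_hom]
  have hu' : IsUnit (aeval (y₀ : Z) (derivative ((h.map ι).map ev))) := by
    have := hu.map ev
    rw [coe_aeval_eq_eval] at this ⊢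
    rwa [derivative_map, eval_map, ← hy, eval₂_hom]
  rw [← hev]
  -- Both z and the specialization of φ at ρ = p j are roots over Z nilpotently close to y₀;
  -- uniqueness in Hensel's lemma identifies them.
  refine (existsUnique_nilpotent_sub_and_aeval_eq_zero hn' hu').unique ⟨hzy, ?_⟩ ⟨?_, ?_⟩
  · rw [coe_aeval_eq_eval, Polynomial.map_map, hevι, ← Polynomial.map_map]
    have h8 : (h.map (evalRingHom (r + p * j))).eval z = 0 := hz
    have := eval₂_hom (p := h.map (evalRingHom (r + p * j))) (Int.castRingHom Z) z
    rw [eval_map]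
    simpa only [h8, eq_intCast, Int.cast_zero] using this
  · have := hφ1.map ev
    rwa [map_sub, hy] at this
  · have := congrArg ev hφ2
    rw [coe_aeval_eq_eval] at this ⊢
    rw [eval_map, eval₂_hom, this, map_zero]

/-- Integral points on a plane curve that are congruent to the same simple point modulo `p`
lie on a common formal branch: on the progression `r + p j` the ordinate is, modulo `p ^ m`, a
polynomial in `j` of degree less than `m`. -/
theorem exists_polynomial_branch {p m : ℕ} (hp : p.Prime) (hm : 0 < m) (h : ℤ[X][X]) (r y₀ : ℤ)
    (h0 : (p : ℤ) ∣ (specialize h r).eval y₀)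
    (h1 : ¬ (p : ℤ) ∣ (specialize (derivative h) r).eval y₀) :
    ∃ ψ : ℤ[X], ψ.degree < m ∧ ∀ j z : ℤ, (specialize h (r + p * j)).eval z = 0 →
      (p : ℤ) ∣ z - y₀ → (p : ℤ) ^ m ∣ z - ψ.eval j := by
  have : Fact (1 < p ^ m) := ⟨Nat.one_lt_pow hm.ne' hp.one_lt⟩
  have hpZ : (((p : ℤ) : ZMod (p ^ m))) ^ m = 0 := by
    have : ((p ^ m : ℕ) : ZMod (p ^ m)) = 0 := ZMod.natCast_self _
    rwa [Nat.cast_pow, ← Int.cast_natCast] at this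
  have hdvdZ : ∀ a : ℤ, (p : ℤ) ∣ a → IsNilpotent (a : ZMod (p ^ m)) := by
    rintro a ⟨b, rfl⟩
    exact ⟨m, by rw [Int.cast_mul, mul_pow, hpZ, zero_mul]⟩
  have hunitZ : IsUnit (((specialize (derivative h) r).eval y₀ : ℤ) : ZMod (p ^ m)) := by
    obtain ⟨u, v, huv⟩ : IsCoprime ((specialize (derivative h) r).eval y₀) ((p : ℤ) ^ m) :=
      IsCoprime.pow_right (((Nat.prime_iff_prime_int.mp hp).coprime_iff_not_dvd.mpr h1).symm)
    refine IsUnit.of_mul_eq_one (u : ZMod (p ^ m)) ?_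
    have := congrArg (Int.cast : ℤ → ZMod (p ^ m)) huv
    rwa [Int.cast_add, Int.cast_mul, Int.cast_mul, Int.cast_pow, hpZ, mul_zero, add_zero,
      Int.cast_one, mul_comm] at this
  obtain ⟨g, hgd, hg⟩ := exists_polynomial_branch_of_nilpotent hpZ h r y₀ (hdvdZ _ h0) hunitZ
  obtain ⟨g', hg', hgd'⟩ : ∃ g' : ℤ[X], g'.map (Int.castRingHom (ZMod (p ^ m))) = g ∧
      g'.degree = g.degree := by
    have : g ∈ lifts (Int.castRingHom (ZMod (p ^ m))) := by
      rw [lifts_iff_coeff_lifts]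
      intro n
      obtain ⟨a, ha⟩ := ZMod.intCast_surjective (g.coeff n)
      exact ⟨a, by simpa using ha⟩
    exact exists_degree_eq_of_mem_lifts this
  refine ⟨g'.comp (C (p : ℤ) * X), ?_, fun j z hz hzy => ?_⟩
  · rw [← hgd', degree_lt_iff_coeff_zero] at hgd
    rw [degree_lt_iff_coeff_zero]
    intro k hk
    rw [comp_C_mul_X_coeff, hgd k hk, zero_mul]
  · have key := hg j z hz (by
      rw [← Int.cast_sub]
      exact hdvdZ _ (by rwa [← neg_sub, dvd_neg]))
    have h7 := eval₂_hom (p := g') (Int.castRingHom (ZMod (p ^ m))) ((p : ℤ) * j)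
    rw [eq_intCast, eq_intCast] at h7
    rw [← hg', eval_map, ← Int.cast_mul, h7, ← sub_eq_zero, ← Int.cast_sub,
      ZMod.intCast_zmod_eq_zero_iff_dvd] at key
    rw [eval_comp]
    simpa using key

/-! ### Interpolation, growth of roots, and degree bounds -/

/-- Lagrange interpolation with bounded integral weights. -/
theorem exists_integral_lagrange (U : Finset ℤ) (m : ℕ) :
    ∃ M : ℤ, 0 ≤ M ∧ ∀ s ⊆ U, s.card = m → ∀ j ∈ U, ∃ W : ℤ, ∃ c : ℤ → ℤ, W ≠ 0 ∧ |W| ≤ M ∧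
      (∀ a ∈ s, |c a| ≤ M) ∧
      ∀ ψ : ℚ[X], ψ.degree < m → W * ψ.eval (j : ℚ) = ∑ a ∈ s, c a * ψ.eval (a : ℚ) := by
  have key : ∀ x : Finset ℤ × ℤ, ∃ M : ℤ, 0 ≤ M ∧ (x.1.card = m → ∃ W : ℤ, ∃ c : ℤ → ℤ,
      W ≠ 0 ∧ |W| ≤ M ∧ (∀ a ∈ x.1, |c a| ≤ M) ∧ ∀ ψ : ℚ[X], ψ.degree < m →
        W * ψ.eval (x.2 : ℚ) = ∑ a ∈ x.1, c a * ψ.eval (a : ℚ)) := by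
    rintro ⟨s, j⟩
    -- The weight W is a common denominator of the values at j of the Lagrange basis polynomials,
    -- and the c a are the resulting numerators.
    obtain ⟨b, hb⟩ := IsLocalization.exist_integer_multiples (nonZeroDivisors ℤ) s
      (fun a => (Lagrange.basis s (fun i : ℤ => (i : ℚ)) a).eval (j : ℚ))
    choose! c hc using hb
    refine ⟨|(b : ℤ)| + ∑ a ∈ s, |c a|, by positivity, fun hs => ⟨b, c,
      nonZeroDivisors.coe_ne_zero b, by
        have : 0 ≤ ∑ a ∈ s, |c a| := by positivity
        linarith, fun a ha => ?_, fun ψ hψ => ?_⟩⟩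
    · have := Finset.single_le_sum (f := fun a => |c a|) (fun i _ => abs_nonneg (c i)) ha
      have h2 : 0 ≤ |(b : ℤ)| := abs_nonneg _
      simp only at this
      linarith
    · have hψ' : ψ.degree < s.card := by rwa [hs]
      have h1 := Lagrange.eq_interpolate (s := s) (v := fun i : ℤ => (i : ℚ))
        (Int.cast_injective.injOn) hψ'
      conv_lhs => rw [h1]
      rw [Lagrange.interpolate_apply, eval_finsetSum, Finset.mul_sum]
      refine Finset.sum_congr rfl fun a ha => ?_
      have := hc a ha
      simp only [algebraMap_int_eq, eq_intCast, zsmul_eq_mul] at this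
      rw [this, eval_mul, eval_C]
      ring
  choose M hM0 hM using key
  -- One bound for all node sets and all j: it must depend on U and m only, as the prime is chosen
  -- afterwards in terms of it.
  refine ⟨∑ x ∈ U.powerset ×ˢ U, M x, Finset.sum_nonneg fun x _ => hM0 x, ?_⟩
  intro s hs hcard j hj
  obtain ⟨W, c, h1, h2, h3, h4⟩ := hM (s, j) hcard
  have hle : M (s, j) ≤ ∑ x ∈ U.powerset ×ˢ U, M x :=
    Finset.single_le_sum (f := M) (fun x _ => hM0 x)
      (Finset.mem_product.mpr ⟨Finset.mem_powerset.mpr hs, hj⟩)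
  exact ⟨W, c, h1, h2.trans hle, fun a ha => (h3 a ha).trans hle, h4⟩

theorem abs_eval_natCast_le (g : ℤ[X]) (k : ℕ) (hk : 1 ≤ k) :
    |g.eval (k : ℤ)| ≤ (∑ i ∈ Finset.range (g.natDegree + 1), |g.coeff i|) *
      (k : ℤ) ^ g.natDegree := by
  rw [eval_eq_sum_range, Finset.sum_mul]
  refine (Finset.abs_sum_le_sum_abs _ _).trans (Finset.sum_le_sum fun i hi => ?_)
  rw [abs_mul, abs_pow, Nat.abs_cast]
  gcongr
  · exact_mod_cast hk
  · exact Nat.lt_succ_iff.mp (Finset.mem_range.mp hi)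

/-- Cauchy's bound: when |y| ≥ 1 every lower power of y is at most |y|^(deg - 1), so the leading
term can be cancelled only if |y| is at most the sum of the other coefficients. -/
theorem abs_root_le_of_monic {g : ℤ[X]} (hg : g.Monic) {y : ℤ} (hy : g.eval y = 0) :
    |y| ≤ ∑ i ∈ Finset.range g.natDegree, |g.coeff i| := by
  rcases eq_or_ne y 0 with rfl | hy0
  · simpa using Finset.sum_nonneg fun i _ => abs_nonneg (g.coeff i)
  have hy1 : 1 ≤ |y| := Int.one_le_abs hy0
  rw [eval_eq_sum_range, Finset.sum_range_succ, coeff_natDegree, hg.leadingCoeff, one_mul] at hy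
  obtain ⟨n, hn⟩ : ∃ n, g.natDegree = n + 1 := by
    refine Nat.exists_eq_succ_of_ne_zero fun h0 => ?_
    simp [h0] at hy
  rw [hn] at hy ⊢
  have h1 : |y| ^ (n + 1) ≤ (∑ i ∈ Finset.range (n + 1), |g.coeff i|) * |y| ^ n := by
    rw [← abs_pow, eq_neg_of_add_eq_zero_right hy, abs_neg, Finset.sum_mul]
    refine (Finset.abs_sum_le_sum_abs _ _).trans (Finset.sum_le_sum fun i hi => ?_)
    rw [abs_mul, abs_pow]
    exact mul_le_mul_of_nonneg_left (pow_le_pow_right₀ hy1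
      (Nat.lt_succ_iff.mp (Finset.mem_range.mp hi))) (abs_nonneg _)
  rw [pow_succ'] at h1
  exact le_of_mul_le_mul_right h1 (by positivity)

theorem specialize_monic {h : ℤ[X][X]} (hh : h.Monic) (c : ℤ) : (specialize h c).Monic :=
  hh.map _

/-- Integral roots of the specializations of a monic polynomial grow at most polynomially. -/
theorem exists_root_growth {h : ℤ[X][X]} (hh : h.Monic) :
    ∃ C d : ℕ, ∀ k : ℕ, 1 ≤ k → ∀ y : ℤ, (specialize h k).eval y = 0 → |y| ≤ C * (k : ℤ) ^ d := by
  let A : ℕ → ℤ := fun i => ∑ l ∈ Finset.range ((h.coeff i).natDegree + 1), |(h.coeff i).coeff l|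
  have hA : ∀ i, 0 ≤ A i := fun i => Finset.sum_nonneg fun _ _ => abs_nonneg _
  refine ⟨(∑ i ∈ Finset.range h.natDegree, A i).toNat,
    ∑ i ∈ Finset.range h.natDegree, (h.coeff i).natDegree, fun k hk y hy => ?_⟩
  have h1 := abs_root_le_of_monic (specialize_monic hh k) hy
  rw [specialize, hh.natDegree_map] at h1
  rw [Int.toNat_of_nonneg (Finset.sum_nonneg fun i _ => hA i), Finset.sum_mul]
  refine h1.trans (Finset.sum_le_sum fun i hi => ?_)
  rw [coeff_map, coe_evalRingHom]
  refine (abs_eval_natCast_le _ k hk).trans ?_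
  refine mul_le_mul_of_nonneg_left ?_ (hA i)
  exact pow_le_pow_right₀ (by exact_mod_cast hk)
    (Finset.single_le_sum (f := fun i => (h.coeff i).natDegree) (fun _ _ => Nat.zero_le _) hi)

theorem overRat_eval_comp (h : ℤ[X][X]) (q l : ℚ[X]) :
    ((overRat h).eval q).comp l =
      ∑ i ∈ Finset.range (h.natDegree + 1),
        ((h.coeff i).map (Int.castRingHom ℚ)).comp l * (q.comp l) ^ i := by
  rw [overRat, eval_map, eval₂_eq_sum_range, ← coe_compRingHom_apply, map_sum]
  simp

theorem overRat_eval_eval (h : ℤ[X][X]) (q : ℚ[X]) (c : ℤ) :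
    ((overRat h).eval q).eval (c : ℚ) = (specialize h c).eval₂ (Int.castRingHom ℚ) (q.eval c) := by
  rw [overRat, specialize, eval₂_map, eval_map, ← coe_evalRingHom, hom_eval₂]
  congr 1
  ext <;> simp

/-- A polynomial of small degree cannot satisfy a plane curve equation at too many points unless
it satisfies it identically. -/
theorem exists_degree_bound (h : ℤ[X][X]) (m : ℕ) :
    ∃ N : ℕ, ∀ (q : ℚ[X]) (r p : ℤ), p ≠ 0 → q.degree < m → ∀ T : Finset ℤ, N < T.card →
      (∀ j ∈ T, ∃ y : ℤ, (y : ℚ) = q.eval (j : ℚ) ∧ (specialize h (r + p * j)).eval y = 0) →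
      ∃ q' : ℚ[X], (overRat h).eval q' = 0 := by
  -- This bounds the degree in t of h(r + p t, q(t)), whatever r, p and q are: the term of index i
  -- contributes at most deg hᵢ + i · deg q.
  refine ⟨∑ i ∈ Finset.range (h.natDegree + 1), (h.coeff i).natDegree + h.natDegree * m, ?_⟩
  intro q r p hp hq T hT hy
  have hp' : (p : ℚ) ≠ 0 := by exact_mod_cast hp
  let l : ℚ[X] := C (p : ℚ) * X + C (r : ℚ)
  let l' : ℚ[X] := C ((p : ℚ)⁻¹) * (X - C (r : ℚ))
  have hl : l'.comp l = X := by
    simp only [l, l', mul_comp, sub_comp, X_comp, C_comp, add_sub_cancel_right, ← mul_assoc, ← C_mul,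
      inv_mul_cancel₀ hp', C_1, one_mul]
  have hll : l.comp l' = X := by
    simp only [l, l', mul_comp, add_comp, X_comp, C_comp, ← mul_assoc, ← C_mul,
      mul_inv_cancel₀ hp', C_1, one_mul, sub_add_cancel]
  refine ⟨q.comp l', ?_⟩
  have hzero : ((overRat h).eval (q.comp l')).comp l = 0 := by
    by_contra hne
    have hdeg : (((overRat h).eval (q.comp l')).comp l).natDegree ≤
        ∑ i ∈ Finset.range (h.natDegree + 1), (h.coeff i).natDegree + h.natDegree * m := by
      rw [overRat_eval_comp, comp_assoc, hl, comp_X]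
      refine natDegree_sum_le_of_forall_le _ _ fun i hi => ?_
      refine natDegree_mul_le.trans (add_le_add ?_ ?_)
      · rw [natDegree_comp]
        have : l.natDegree = 1 := natDegree_linear hp'
        rw [this, mul_one]
        exact (natDegree_map_le).trans (Finset.single_le_sum
          (f := fun i => (h.coeff i).natDegree) (fun _ _ => Nat.zero_le _) hi)
      · refine natDegree_pow_le.trans (Nat.mul_le_mul ?_ ?_)
        · exact Nat.lt_succ_iff.mp (Finset.mem_range.mp hi)
        · exact natDegree_le_of_degree_le hq.le
    refine absurd hT (not_lt.mpr (le_trans ?_ hdeg))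
    rw [← Finset.card_image_of_injective T (Int.cast_injective (α := ℚ))]
    refine card_le_degree_of_subset_roots fun x hx => ?_
    obtain ⟨j, hj, rfl⟩ := Finset.mem_image.mp hx
    obtain ⟨y, hy1, hy2⟩ := hy j hj
    rw [mem_roots hne, IsRoot.def, eval_comp]
    have h1 : l.eval (j : ℚ) = ((r + p * j : ℤ) : ℚ) := by
      simp only [l, eval_add, eval_mul, eval_C, eval_X]; push_cast; ring
    rw [h1, overRat_eval_eval, ← h1, ← eval_comp, comp_assoc, hl, comp_X, ← hy1]
    have := eval₂_hom (p := specialize h (r + p * j)) (Int.castRingHom ℚ) y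
    rw [hy2] at this
    simpa using this
  have := congrArg (fun P => P.comp l') hzero
  simpa [comp_assoc, hll] using this

theorem eval_specialize_modEq (h : ℤ[X][X]) {p r c y z : ℤ} (hc : p ∣ c - r) (hz : p ∣ z - y) :
    p ∣ (specialize h c).eval z - (specialize h r).eval y := by
  have h1 := hz.trans (sub_dvd_eval_sub z y (specialize h c))
  have h2 : p ∣ (specialize h c).eval y - (specialize h r).eval y := by
    rw [eval_specialize, eval_specialize]
    exact hc.trans (sub_dvd_eval_sub c r _)
  have := dvd_add h1 h2
  simpa using this

/-! ### Hilbert irreducibility for integral points -/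

/-- A form of Hilbert's irreducibility theorem: if each natural number `k` is the abscissa of an
integral point on one of finitely many curves `hᵢ(t, x) = 0`, with `hᵢ` monic and separable in `x`,
then one of the `hᵢ` has a root in `ℚ[t]`. -/
theorem exists_polynomial_root_of_forall_exists_root {ι : Type*} [Finite ι] (h : ι → ℤ[X][X])
    (hmon : ∀ i, (h i).Monic)
    (hsep : ∀ i, ∃ (A B : ℤ[X][X]) (D : ℤ[X]), D ≠ 0 ∧ A * h i + B * derivative (h i) = C D)
    (hroot : ∀ k : ℕ, ∃ i, ∃ y : ℤ, (specialize (h i) k).eval y = 0) :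
    ∃ i, ∃ q : ℚ[X], (overRat (h i)).eval q = 0 := by
  classical
  have := Fintype.ofFinite ι
  choose A B D hD0 hD using hsep
  -- a good base point
  obtain ⟨r, hr1, hr⟩ : ∃ r : ℕ, 1 ≤ r ∧ ∀ i, (D i).eval (r : ℤ) ≠ 0 := by
    have hne : ∏ i, D i ≠ 0 := Finset.prod_ne_zero_iff.mpr fun i _ => hD0 i
    by_contra hcon
    push Not at hcon
    refine hne (eq_zero_of_infinite_isRoot _ (Set.Infinite.mono ?_
      (Set.infinite_range_of_injective
        ((Nat.cast_injective (R := ℤ)).comp (add_left_injective 1)))))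
    rintro _ ⟨r, rfl⟩
    obtain ⟨i, hi⟩ := hcon (r + 1) (Nat.le_add_left 1 r)
    rw [Set.mem_ofPred_eq, IsRoot.def, eval_prod]
    exact Finset.prod_eq_zero (Finset.mem_univ i) hi
  choose i y hy using hroot
  choose C' d' hgrow using fun i => exists_root_growth (hmon i)
  set c := ∑ i, C' i with hc
  set d := ∑ i, d' i with hd
  set m := d + 1 with hm
  choose N hN using fun i => exists_degree_bound (h i) m
  -- A fibre with more than b points contains m interpolation nodes and still has more points than
  -- any of the degree bounds N i.
  set b := m + ∑ i, N i with hb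
  -- There are at most n pairs (curve, root modulo p) above r, so n b + 1 abscissas force some pair
  -- to occur more than b times.
  set n := ∑ i, (h i).natDegree with hn
  set U : Finset ℤ := (Finset.range (n * b + 1)).image Nat.cast with hU
  have hUcard : U.card = n * b + 1 := by
    rw [hU, Finset.card_image_of_injective _ Nat.cast_injective, Finset.card_range]
  obtain ⟨M, hM0, hM⟩ := exists_integral_lagrange U m
  -- a large prime
  set K : ℤ := (m + 1) * M * c * (r + (n * b + 1)) ^ d with hK
  obtain ⟨p, hpge, hp⟩ := Nat.exists_infinite_primes
    (K.toNat + ∑ i, ((D i).eval (r : ℤ)).natAbs + 1)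
  have : Fact p.Prime := ⟨hp⟩
  have hpK : K < p := by
    have := Int.self_le_toNat K
    have h2 : ((K.toNat + ∑ i, ((D i).eval (r : ℤ)).natAbs + 1 : ℕ) : ℤ) ≤ p := by
      exact_mod_cast hpge
    push_cast at h2
    have h3 : 0 ≤ ∑ i, |(D i).eval (r : ℤ)| := Finset.sum_nonneg fun _ _ => abs_nonneg _
    linarith
  have hpD : ∀ i, ¬ (p : ℤ) ∣ (D i).eval (r : ℤ) := by
    intro i hdvd
    have h1 := Nat.le_of_dvd (Int.natAbs_pos.mpr (hr i)) (Int.natCast_dvd.mp hdvd)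
    have h2 := Finset.single_le_sum (f := fun i => ((D i).eval (r : ℤ)).natAbs)
      (fun _ _ => Nat.zero_le _) (Finset.mem_univ i)
    omega
  -- the points under consideration
  let k : ℤ → ℕ := fun j => r + p * j.toNat
  have hk : ∀ j ∈ U, ((k j : ℕ) : ℤ) = r + p * j := by
    intro j hj
    obtain ⟨j', -, rfl⟩ := Finset.mem_image.mp hj
    simp [k]
  let t : Finset (Σ _ : ι, ZMod p) := Finset.univ.sigma fun i =>
    ((specialize (h i) r).map (Int.castRingHom (ZMod p))).roots.toFinset
  have htcard : t.card ≤ n := by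
    rw [Finset.card_sigma]
    refine Finset.sum_le_sum fun i _ => ?_
    refine (Multiset.toFinset_card_le _).trans ((card_roots' _).trans ?_)
    refine natDegree_map_le.trans ?_
    exact natDegree_map_le
  have hmaps : ∀ j ∈ U, (⟨i (k j), (y (k j) : ZMod p)⟩ : Σ _ : ι, ZMod p) ∈ t := by
    intro j hj
    simp only [t, Finset.mem_sigma, Finset.mem_univ, true_and, Multiset.mem_toFinset]
    rw [mem_roots (((specialize_monic (hmon _) _).map _).ne_zero), IsRoot.def, eval_map]
    have h1 := eval₂_hom (p := specialize (h (i (k j))) r) (Int.castRingHom (ZMod p)) (y (k j))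
    rw [eq_intCast] at h1
    rw [h1, eq_intCast, ZMod.intCast_zmod_eq_zero_iff_dvd]
    have h2 := eval_specialize_modEq (h (i (k j))) (p := p) (r := r) (c := k j) (y := y (k j))
      (z := y (k j)) ⟨j, by rw [hk j hj]; ring⟩ (by simp)
    rw [hy, zero_sub, dvd_neg] at h2
    exact h2
  obtain ⟨⟨i₀, y₀⟩, hmem, hfib⟩ := Finset.exists_lt_card_fiber_of_mul_lt_card_of_maps_to hmaps
    (n := b) (by rw [hUcard]; exact Nat.lt_succ_of_le (Nat.mul_le_mul_right _ htcard))
  set T := {j ∈ U | (⟨i (k j), (y (k j) : ZMod p)⟩ : Σ _ : ι, ZMod p) = ⟨i₀, y₀⟩} with hT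
  have hTU : T ⊆ U := Finset.filter_subset _ _
  have hTi : ∀ j ∈ T, i (k j) = i₀ := by
    intro j hj
    have := (Finset.mem_filter.mp hj).2
    exact congrArg Sigma.fst this
  have hTy : ∀ j ∈ T, (y (k j) : ZMod p) = y₀ := by
    intro j hj
    have := (Finset.mem_filter.mp hj).2
    simp only [Sigma.mk.injEq, heq_eq_eq] at this
    exact this.2
  have hcurve : ∀ j ∈ T, (specialize (h i₀) (r + p * j)).eval (y (k j)) = 0 := by
    intro j hj
    have := hy (k j)
    rwa [hTi j hj, hk j (hTU hj)] at this
  obtain ⟨s, hsT, hscard⟩ := Finset.exists_subset_card_eq (s := T) (n := m) (by omega)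
  obtain ⟨j₀, hj₀⟩ : T.Nonempty := Finset.card_pos.mp (by omega)
  have hcong : ∀ j ∈ T, (p : ℤ) ∣ y (k j) - y (k j₀) := by
    intro j hj
    rw [← ZMod.intCast_zmod_eq_zero_iff_dvd, Int.cast_sub, hTy j hj, hTy j₀ hj₀, sub_self]
  have h0 : (p : ℤ) ∣ (specialize (h i₀) r).eval (y (k j₀)) := by
    have h2 := eval_specialize_modEq (h i₀) (p := p) (r := r) (c := r + p * j₀) (y := y (k j₀))
      (z := y (k j₀)) ⟨j₀, by ring⟩ (by simp)
    rwa [hcurve j₀ hj₀, zero_sub, dvd_neg] at h2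
  -- A double root modulo p would make p divide D(r), through the Bézout relation between h and its
  -- derivative.
  have h1 : ¬ (p : ℤ) ∣ (specialize (derivative (h i₀)) r).eval (y (k j₀)) := by
    intro h1
    refine hpD i₀ ?_
    have := congrArg (fun P => (specialize P r).eval (y (k j₀))) (hD i₀)
    simp only [specialize, Polynomial.map_add, Polynomial.map_mul, eval_add, eval_mul, map_C,
      eval_C, coe_evalRingHom] at this
    rw [← this]
    exact dvd_add (dvd_mul_of_dvd_right h0 _) (dvd_mul_of_dvd_right h1 _)
  obtain ⟨ψ, hψd, hψ⟩ := exists_polynomial_branch hp (Nat.succ_pos d) (h i₀) r (y (k j₀)) h0 h1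
  have hψT : ∀ j ∈ T, (p : ℤ) ^ m ∣ y (k j) - ψ.eval j := fun j hj =>
    hψ j _ (hcurve j hj) (hcong j hj)
  have hybound : ∀ j ∈ T, |y (k j)| ≤ c * (r + (n * b + 1)) ^ d * p ^ d := by
    intro j hj
    obtain ⟨j', hj', rfl⟩ := Finset.mem_image.mp (hTU hj)
    have hj'' : (j' : ℤ) ≤ n * b := by
      exact_mod_cast Nat.lt_succ_iff.mp (Finset.mem_range.mp hj')
    have hp1 : (1 : ℤ) ≤ p := by exact_mod_cast hp.one_lt.le
    have hk1 : 1 ≤ k j' := hr1.trans (Nat.le_add_right _ _)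
    have hkle : (k j' : ℤ) ≤ (r + (n * b + 1)) * p := by
      rw [hk _ (hTU hj)]
      have h3 : (r : ℤ) * 1 ≤ r * p := by gcongr
      have h4 : (p : ℤ) * j' ≤ p * (n * b) := by gcongr
      linarith
    have h5 := hgrow (i (k j')) (k j') hk1 _ (hy (k j'))
    have h6 : (C' (i (k j')) : ℤ) ≤ c := by
      exact_mod_cast Finset.single_le_sum (f := C') (fun _ _ => Nat.zero_le _) (Finset.mem_univ _)
    have h7 : d' (i (k j')) ≤ d :=
      Finset.single_le_sum (f := d') (fun _ _ => Nat.zero_le _) (Finset.mem_univ _)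
    calc |y (k j')| ≤ C' (i (k j')) * (k j' : ℤ) ^ d' (i (k j')) := h5
      _ ≤ c * (k j' : ℤ) ^ d := by
        refine mul_le_mul h6 (pow_le_pow_right₀ (by exact_mod_cast hk1) h7) (by positivity)
          (by positivity)
      _ ≤ c * ((r + (n * b + 1)) * p) ^ d := by gcongr
      _ = _ := by rw [mul_pow, mul_assoc]
  -- Only the m nodes of s determine q; that q also passes through every other point of T is the
  -- content of `hqT`.
  let q : ℚ[X] := Lagrange.interpolate s (fun i : ℤ => (i : ℚ)) fun j => (y (k j) : ℚ)
  have hqd : q.degree < m := by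
    rw [← hscard]; exact Lagrange.degree_interpolate_lt _ Int.cast_injective.injOn
  have hqs : ∀ a ∈ s, q.eval (a : ℚ) = y (k a) := fun a ha =>
    Lagrange.eval_interpolate_at_node (v := fun i : ℤ => (i : ℚ)) _ Int.cast_injective.injOn ha
  have hqT : ∀ j ∈ T, (y (k j) : ℚ) = q.eval (j : ℚ) := by
    intro j hj
    obtain ⟨W, w, hW0, hWM, hwM, hlag⟩ := hM s (hsT.trans hTU) hscard j (hTU hj)
    have hψlag : W * ψ.eval j = ∑ a ∈ s, w a * ψ.eval a := by
      have := hlag (ψ.map (Int.castRingHom ℚ)) (degree_map_le.trans_lt hψd)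
      have he : ∀ a : ℤ, (ψ.map (Int.castRingHom ℚ)).eval (a : ℚ) = ((ψ.eval a : ℤ) : ℚ) := by
        intro a; rw [eval_intCast_map, eq_intCast, Int.cast_id]
      simp only [he] at this
      exact_mod_cast this
    have hE : (p : ℤ) ^ m ∣ W * y (k j) - ∑ a ∈ s, w a * y (k a) := by
      have : W * y (k j) - ∑ a ∈ s, w a * y (k a) =
          W * (y (k j) - ψ.eval j) - ∑ a ∈ s, w a * (y (k a) - ψ.eval a) := by
        simp only [mul_sub, Finset.sum_sub_distrib, ← hψlag]; ring
      rw [this]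
      exact dvd_sub (dvd_mul_of_dvd_right (hψT j hj) _)
        (Finset.dvd_sum fun a ha => dvd_mul_of_dvd_right (hψT a (hsT ha)) _)
    -- A multiple of p^m is compared with a sum of m + 1 terms, each at most M c (r + n b + 1)^d
    -- p^d. The total is K p^d, which is below p^(d+1) = p^m because p > K.
    have hE0 : W * y (k j) - ∑ a ∈ s, w a * y (k a) = 0 := by
      refine Int.eq_zero_of_abs_lt_dvd hE ?_
      have hY : ∀ v : ℤ, |v| ≤ M → ∀ a ∈ T,
          |v * y (k a)| ≤ M * (c * (r + (n * b + 1)) ^ d * p ^ d) := by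
        intro v hv a ha
        rw [abs_mul]
        exact mul_le_mul hv (hybound a ha) (abs_nonneg _) hM0
      calc |W * y (k j) - ∑ a ∈ s, w a * y (k a)|
          ≤ |W * y (k j)| + |∑ a ∈ s, w a * y (k a)| := abs_sub _ _
        _ ≤ M * (c * (r + (n * b + 1)) ^ d * p ^ d) +
            ∑ a ∈ s, M * (c * (r + (n * b + 1)) ^ d * p ^ d) :=
          add_le_add (hY W hWM j hj) ((Finset.abs_sum_le_sum_abs _ _).trans
            (Finset.sum_le_sum fun a ha => hY _ (hwM a ha) a (hsT ha)))
        _ = K * p ^ d := by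
          rw [Finset.sum_const, hscard, nsmul_eq_mul, hK]; ring
        _ < p ^ m := by
          rw [hm, pow_succ']
          exact mul_lt_mul_of_pos_right hpK (pow_pos (by exact_mod_cast hp.pos) _)
    have h2 := hlag q hqd
    rw [Finset.sum_congr rfl fun a ha => by rw [hqs a ha]] at h2
    have h3 : (W : ℚ) * y (k j) = ∑ a ∈ s, (w a : ℚ) * y (k a) := by
      exact_mod_cast sub_eq_zero.mp hE0
    exact mul_left_cancel₀ (Int.cast_ne_zero.mpr hW0) (h3.trans h2.symm)
  refine ⟨i₀, hN i₀ q r p (by exact_mod_cast hp.ne_zero) hqd T ?_ fun j hj =>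
    ⟨y (k j), hqT j hj, hcurve j hj⟩⟩
  have := Finset.single_le_sum (f := N) (fun _ _ => Nat.zero_le _) (Finset.mem_univ i₀)
  omega

/-- The affine substitution `t ↦ a + b t` in a polynomial `h(t, x)`. -/
def affineSubst (h : ℤ[X][X]) (a b : ℤ) : ℤ[X][X] := h.map (compRingHom (C b * X + C a))

theorem specialize_affineSubst (h : ℤ[X][X]) (a b c : ℤ) :
    specialize (affineSubst h a b) c = specialize h (a + b * c) := by
  rw [specialize, specialize, affineSubst, Polynomial.map_map]
  congr 1
  apply Polynomial.ringHom_ext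
  · intro x; simp
  · simp [add_comm]

theorem overRat_affineSubst_eval (h : ℤ[X][X]) (a b : ℤ) (q : ℚ[X]) :
    (overRat (affineSubst h a b)).eval (q.comp (C (b : ℚ) * X + C (a : ℚ))) =
      ((overRat h).eval q).comp (C (b : ℚ) * X + C (a : ℚ)) := by
  have h1 : (mapRingHom (Int.castRingHom ℚ)).comp (compRingHom (C b * X + C a)) =
      (compRingHom (C (b : ℚ) * X + C (a : ℚ))).comp (mapRingHom (Int.castRingHom ℚ)) := by
    apply Polynomial.ringHom_ext
    · intro x; simp
    · simp
  rw [overRat, affineSubst, Polynomial.map_map, h1, ← Polynomial.map_map, ← overRat, eval_map,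
    ← coe_compRingHom_apply, eval₂_hom, coe_compRingHom_apply]

/-- Hilbert irreducibility in an arithmetic progression: finitely many curves `hᵢ(t, x) = 0`
without a component of degree one over the `t`-line have no integral point above infinitely many
members of a progression. -/
theorem exists_mem_progression_forall_no_root {ι : Type*} [Finite ι] (h : ι → ℤ[X][X])
    (hmon : ∀ i, (h i).Monic)
    (hsep : ∀ i, ∃ (A B : ℤ[X][X]) (D : ℤ[X]), D ≠ 0 ∧ A * h i + B * derivative (h i) = C D)
    (hroot : ∀ i, ∀ q : ℚ[X], (overRat (h i)).eval q ≠ 0)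
    (a b : ℤ) (hb : b ≠ 0) (Z : Set ℤ) (hZ : Z.Finite) :
    ∃ k : ℤ, a + b * k ∉ Z ∧ ∀ i, ∀ y : ℤ, (specialize (h i) (a + b * k)).eval y ≠ 0 := by
  have hinj : Function.Injective fun k : ℕ => a + b * (k : ℤ) := by
    intro k l hkl
    simpa [hb] using hkl
  -- Starting the progression at k₀ puts all later members outside Z, so a failure of the claim
  -- gives an integral point above every natural number.
  obtain ⟨k₀, hk₀⟩ : ∃ k₀ : ℕ, ∀ k : ℕ, k₀ ≤ k → a + b * (k : ℤ) ∉ Z := by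
    obtain ⟨k₀, hk₀⟩ := (hZ.preimage hinj.injOn).bddAbove
    exact ⟨k₀ + 1, fun k hk hmem => absurd (hk₀ hmem) (by omega)⟩
  by_contra hcon
  push Not at hcon
  have hbQ : (b : ℚ) ≠ 0 := by exact_mod_cast hb
  obtain ⟨i, q, hq⟩ := exists_polynomial_root_of_forall_exists_root
    (fun i => affineSubst (h i) (a + b * k₀) b) (fun i => (hmon i).map _)
    (fun i => by
      obtain ⟨A, B, D, hD, hAB⟩ := hsep i
      refine ⟨affineSubst A (a + b * k₀) b, affineSubst B (a + b * k₀) b,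
        D.comp (C b * X + C (a + b * k₀)), ?_, ?_⟩
      · rw [Ne, comp_eq_zero_iff]
        rintro (h0 | ⟨-, h0⟩)
        · exact hD h0
        · have := congrArg (fun P => P.coeff 1) h0
          simp [hb] at this
      · have := congrArg (Polynomial.map (compRingHom (C b * X + C (a + b * k₀)))) hAB
        rw [Polynomial.map_add, Polynomial.map_mul, Polynomial.map_mul, map_C] at this
        simpa [affineSubst, derivative_map] using this)
    (fun k => by
      obtain ⟨i, y, hy⟩ := hcon (k₀ + k) (by
        have := hk₀ (k₀ + k) (Nat.le_add_right _ _)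
        simpa using this)
      refine ⟨i, y, ?_⟩
      rw [specialize_affineSubst, ← hy]
      congr 2; ring)
  refine hroot i (q.comp (C ((b : ℚ)⁻¹) * (X - C ((a + b * k₀ : ℤ) : ℚ)))) ?_
  have h1 := overRat_affineSubst_eval (h i) (a + b * k₀) b
    (q.comp (C ((b : ℚ)⁻¹) * (X - C ((a + b * k₀ : ℤ) : ℚ))))
  have h2 : (C ((b : ℚ)⁻¹) * (X - C ((a + b * k₀ : ℤ) : ℚ))).comp
      (C (b : ℚ) * X + C ((a + b * k₀ : ℤ) : ℚ)) = X := by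
    simp only [mul_comp, sub_comp, X_comp, C_comp, add_sub_cancel_right, ← mul_assoc, ← C_mul,
      inv_mul_cancel₀ hbQ, C_1, one_mul]
  rw [comp_assoc, h2, comp_X, hq] at h1
  rcases comp_eq_zero_iff.mp h1.symm with h0 | ⟨-, h0⟩
  · exact h0
  · have := congrArg (fun P => P.coeff 1) h0
    simp [hb] at this

/-! ### Elements integral over ℤ[t] and extension of specializations -/

/-- The canonical map from `ℤ[t]` to an extension of `ℚ(t)`. -/
def intPolyHom (E : Type*) [Field E] [Algebra (RatFunc ℚ) E] : ℤ[X] →+* E :=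
  (algebraMap (RatFunc ℚ) E).comp
    ((algebraMap ℚ[X] (RatFunc ℚ)).comp (mapRingHom (Int.castRingHom ℚ)))

/-- This makes ℚ(t) the fraction field of the integrally closed ring ℤ[t], so that minimal
polynomials of integral elements have coefficients in ℤ[t]. -/
theorem ratFunc_exists_int_div (z : RatFunc ℚ) : ∃ x y : ℤ[X], y ≠ 0 ∧
    z * intPolyHom (RatFunc ℚ) y = intPolyHom (RatFunc ℚ) x := by
  obtain ⟨x, y, hy, rfl⟩ := IsFractionRing.div_surjective (A := ℚ[X]) z
  obtain ⟨n, hn0, hn⟩ := IsLocalization.integerNormalization_spec (nonZeroDivisors ℤ) x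
  obtain ⟨m, hm0, hm⟩ := IsLocalization.integerNormalization_spec (nonZeroDivisors ℤ) y
  have hy0 : algebraMap ℚ[X] (RatFunc ℚ) y ≠ 0 :=
    (map_ne_zero_iff _ (IsFractionRing.injective ℚ[X] _)).mpr (nonZeroDivisors.ne_zero hy)
  have hn' : intPolyHom (RatFunc ℚ) (IsLocalization.integerNormalization (nonZeroDivisors ℤ) x) =
      n * algebraMap _ _ x := by
    have := congrArg (algebraMap ℚ[X] (RatFunc ℚ)) hn
    rw [zsmul_eq_mul, map_mul, map_intCast] at this
    exact this
  have hm' : intPolyHom (RatFunc ℚ) (IsLocalization.integerNormalization (nonZeroDivisors ℤ) y) =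
      m * algebraMap _ _ y := by
    have := congrArg (algebraMap ℚ[X] (RatFunc ℚ)) hm
    rw [zsmul_eq_mul, map_mul, map_intCast] at this
    exact this
  refine ⟨C m * IsLocalization.integerNormalization (nonZeroDivisors ℤ) x,
    C n * IsLocalization.integerNormalization (nonZeroDivisors ℤ) y, ?_, ?_⟩
  · refine mul_ne_zero (C_ne_zero.mpr (nonZeroDivisors.ne_zero hn0)) ?_
    rw [Ne, IsLocalization.integerNormalization_eq_zero_iff le_rfl]
    exact nonZeroDivisors.ne_zero hy
  · have hC : ∀ a : ℤ, intPolyHom (RatFunc ℚ) (C a) = a := fun a => by simp [intPolyHom]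
    rw [map_mul, map_mul, hn', hm', hC, hC]
    field_simp

theorem intPolyHom_injective (E : Type*) [Field E] [Algebra (RatFunc ℚ) E] :
    Function.Injective (intPolyHom E) := by
  refine (algebraMap (RatFunc ℚ) E).injective.comp ((IsFractionRing.injective ℚ[X] _).comp ?_)
  exact map_injective _ Int.cast_injective

/-- The minimal polynomial of an element that is integral over `ℤ[t]` but does not lie in
`ℚ(t)`. -/
theorem exists_integral_minpoly {E : Type*} [Field E] [Algebra (RatFunc ℚ) E] {θ : E}
    (hθ : (intPolyHom E).IsIntegralElem θ) (hK : θ ∉ (algebraMap (RatFunc ℚ) E).range) :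
    ∃ h : ℤ[X][X], h.Monic ∧ h.eval₂ (intPolyHom E) θ = 0 ∧
      (∃ (A B : ℤ[X][X]) (D : ℤ[X]), D ≠ 0 ∧ A * h + B * derivative h = C D) ∧
      ∀ q : ℚ[X], (overRat h).eval q ≠ 0 := by
  let : Algebra ℤ[X] (RatFunc ℚ) := (intPolyHom (RatFunc ℚ)).toAlgebra
  let : Algebra ℤ[X] E := (intPolyHom E).toAlgebra
  have : IsScalarTower ℤ[X] (RatFunc ℚ) E := IsScalarTower.of_algebraMap_eq fun _ => rfl
  have : FaithfulSMul ℤ[X] (RatFunc ℚ) :=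
    (faithfulSMul_iff_algebraMap_injective _ _).mpr (intPolyHom_injective _)
  have : IsFractionRing ℤ[X] (RatFunc ℚ) := by
    refine IsFractionRing.of_field _ _ fun z => ?_
    obtain ⟨x, y, hy, hxy⟩ := ratFunc_exists_int_div z
    refine ⟨x, y, ?_⟩
    rw [eq_div_iff]
    · exact hxy
    · exact (map_ne_zero_iff _ (intPolyHom_injective _)).mpr hy
  have hinteg : IsIntegral ℤ[X] θ := hθ
  have hmp := minpoly.isIntegrallyClosed_eq_field_fractions' (RatFunc ℚ) hinteg
  have hinteg' : IsIntegral (RatFunc ℚ) θ := hinteg.tower_top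
  have hirr := minpoly.irreducible hinteg'
  have hmon := minpoly.monic hinteg
  refine ⟨minpoly ℤ[X] θ, hmon, minpoly.aeval ℤ[X] θ, ?_, ?_⟩
  · have hpos : (minpoly ℤ[X] θ).natDegree ≠ 0 := (minpoly.natDegree_pos hinteg).ne'
    -- D is the resultant of the minimal polynomial and its derivative, nonzero because irreducible
    -- polynomials over ℚ(t) are separable.
    obtain ⟨p, q, -, -, hpq⟩ := exists_mul_add_mul_eq_C_resultant (minpoly ℤ[X] θ)
      (derivative (minpoly ℤ[X] θ)) le_rfl le_rfl (Or.inl hpos)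
    refine ⟨p, q, _, ?_, by rw [mul_comm p, mul_comm q]; exact hpq⟩
    intro h0
    have hco : IsCoprime (minpoly (RatFunc ℚ) θ) (derivative (minpoly (RatFunc ℚ) θ)) :=
      hirr.separable
    refine resultant_ne_zero _ _ hco ?_
    have hinj : Function.Injective (algebraMap ℤ[X] (RatFunc ℚ)) := intPolyHom_injective _
    rw [hmp, derivative_map, natDegree_map_eq_of_injective hinj,
      natDegree_map_eq_of_injective hinj, resultant_map_map, h0, map_zero]
  · intro q hq
    have hr : (minpoly (RatFunc ℚ) θ).IsRoot (algebraMap ℚ[X] _ q) := by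
      have h1 : (minpoly ℤ[X] θ).map (algebraMap ℤ[X] (RatFunc ℚ)) =
          (overRat (minpoly ℤ[X] θ)).map (algebraMap ℚ[X] (RatFunc ℚ)) := by
        rw [overRat, Polynomial.map_map]; rfl
      rw [hmp, h1, IsRoot.def, eval_map, eval₂_hom, hq, map_zero]
    have hd := degree_eq_one_of_irreducible_of_root hirr hr
    exact hK (minpoly.mem_range_of_degree_eq_one _ _ hd)

/-- A homomorphism to an algebraically closed field extends along an integral extension. -/
theorem exists_ringHom_extension {A B Ω : Type*} [CommRing A] [CommRing B] [Algebra A B]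
    [FaithfulSMul A B] [Algebra.IsIntegral A B] [Field Ω] [IsAlgClosed Ω] (φ : A →+* Ω) :
    ∃ π : B →+* Ω, π.comp (algebraMap A B) = φ := by
  have hP : (RingHom.ker φ).IsPrime := RingHom.ker_isPrime φ
  -- Lying over: B/Q is algebraic over A/ker φ, which embeds in Ω, and an algebraic extension embeds
  -- in an algebraically closed field.
  obtain ⟨Q, -, hQ, hQP⟩ := Ideal.exists_ideal_over_prime_of_isIntegral (S := B) (RingHom.ker φ) ⊥
    (by
      rw [← RingHom.ker_eq_comap_bot, (RingHom.injective_iff_ker_eq_bot _).mp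
        (FaithfulSMul.algebraMap_injective A B)]
      exact bot_le)
  have : Q.LiesOver (RingHom.ker φ) := ⟨hQP.symm⟩
  let : Algebra (A ⧸ RingHom.ker φ) Ω := (RingHom.kerLift φ).toAlgebra
  have : FaithfulSMul (A ⧸ RingHom.ker φ) Ω :=
    (faithfulSMul_iff_algebraMap_injective _ _).mpr (RingHom.kerLift_injective φ)
  have : IsDomain (A ⧸ RingHom.ker φ) := Ideal.Quotient.isDomain _
  have : IsDomain (B ⧸ Q) := Ideal.Quotient.isDomain _
  have : Module.IsTorsionFree (A ⧸ RingHom.ker φ) (B ⧸ Q) :=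
    Module.isTorsionFree_iff_faithfulSMul.mpr inferInstance
  have : Module.IsTorsionFree (A ⧸ RingHom.ker φ) Ω :=
    Module.isTorsionFree_iff_faithfulSMul.mpr inferInstance
  have : Algebra.IsAlgebraic (A ⧸ RingHom.ker φ) (B ⧸ Q) := Algebra.IsIntegral.isAlgebraic
  let l : (B ⧸ Q) →ₐ[A ⧸ RingHom.ker φ] Ω := IsAlgClosed.lift
  refine ⟨l.toRingHom.comp (Ideal.Quotient.mk Q), ?_⟩
  ext a
  have := l.commutes (Ideal.Quotient.mk _ a)
  exact this

instance isAlgebraic_rat_algebraicClosure : Algebra.IsAlgebraic ℚ (AlgebraicClosure ℚ) :=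
  AlgebraicClosure.isAlgebraic ℚ

theorem overRatFunc_monic {F : ℤ[X][X]} (hF : F.Monic) : (overRatFunc F).Monic :=
  (hF.map _).map _

theorem map_overRatFunc {F : ℤ[X][X]} {E : Type*} [Field E] [Algebra (RatFunc ℚ) E] :
    (overRatFunc F).map (algebraMap (RatFunc ℚ) E) = F.map (intPolyHom E) := by
  rw [overRatFunc, overRat, Polynomial.map_map, Polynomial.map_map]; rfl

theorem isGalois_of_isSplittingField (F : ℤ[X][X]) (E : Type*) [Field E] [Algebra (RatFunc ℚ) E]
    [(overRatFunc F).IsSplittingField (RatFunc ℚ) E] : IsGalois (RatFunc ℚ) E :=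
  have : Normal (RatFunc ℚ) E := Normal.of_isSplittingField (overRatFunc F)
  { }

/-! ### The ring of generic roots and its decomposition groups -/

section RootRing

variable (F : ℤ[X][X]) (E : Type*) [Field E] [Algebra (RatFunc ℚ) E] [Algebra ℚ[X] E]
  [IsScalarTower ℚ[X] (RatFunc ℚ) E]

/-- The ring generated over `ℚ[t]` by the roots of `F` in an extension of `ℚ(t)`. -/
def rootRing : Subalgebra ℚ[X] E := Algebra.adjoin ℚ[X] ((overRatFunc F).rootSet E)

variable {F E}

theorem smul_mem_rootRing (σ : E ≃ₐ[RatFunc ℚ] E) {x : E} (hx : x ∈ rootRing F E) :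
    σ x ∈ rootRing F E := by
  induction hx using Algebra.adjoin_induction with
  | mem x hx =>
    refine Algebra.subset_adjoin ?_
    rw [mem_rootSet] at hx ⊢
    exact ⟨hx.1, by
      rw [← AlgEquiv.coe_toAlgHom, aeval_algHom_apply, hx.2, map_zero]⟩
  | algebraMap r =>
    rw [IsScalarTower.algebraMap_apply ℚ[X] (RatFunc ℚ) E, σ.commutes,
      ← IsScalarTower.algebraMap_apply]
    exact Subalgebra.algebraMap_mem _ r
  | add x y _ _ hx hy => rw [map_add]; exact add_mem hx hy
  | mul x y _ _ hx hy => rw [map_mul]; exact mul_mem hx hy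

instance : MulSemiringAction (E ≃ₐ[RatFunc ℚ] E) (rootRing F E) where
  smul σ x := ⟨σ x, smul_mem_rootRing σ x.2⟩
  one_smul _ := Subtype.ext rfl
  mul_smul _ _ _ := Subtype.ext rfl
  smul_zero σ := Subtype.ext (map_zero σ)
  smul_add σ x y := Subtype.ext (map_add σ (x : E) y)
  smul_one σ := Subtype.ext (map_one σ)
  smul_mul σ x y := Subtype.ext (map_mul σ (x : E) y)

@[simp]
theorem coe_smul_rootRing (σ : E ≃ₐ[RatFunc ℚ] E) (x : rootRing F E) :
    ((σ • x : rootRing F E) : E) = σ x := rfl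

theorem algebraMap_polynomial_injective : Function.Injective (algebraMap ℚ[X] E) := by
  rw [IsScalarTower.algebraMap_eq ℚ[X] (RatFunc ℚ) E]
  exact (algebraMap (RatFunc ℚ) E).injective.comp (IsFractionRing.injective ℚ[X] _)

theorem isIntegral_rootRing (hF : F.Monic) : Algebra.IsIntegral ℚ[X] (rootRing F E) := by
  refine Algebra.IsIntegral.adjoin fun x hx => ?_
  refine ⟨overRat F, hF.map _, ?_⟩
  have := (mem_rootSet.mp hx).2
  rwa [overRatFunc, aeval_map_algebraMap] at this

instance : SMulCommClass (E ≃ₐ[RatFunc ℚ] E) ℚ[X] (rootRing F E) where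
  smul_comm σ a x := Subtype.ext (by
    rw [coe_smul_rootRing, Subalgebra.coe_smul, Subalgebra.coe_smul, coe_smul_rootRing,
      Algebra.smul_def, map_mul, Algebra.smul_def,
      IsScalarTower.algebraMap_apply ℚ[X] (RatFunc ℚ) E, σ.commutes])

/-- An invariant element lies in ℚ(t) by Galois theory and is integral over ℚ[t], which is
integrally closed. Invariance is what makes the decomposition group surject onto the automorphisms
of the residue extension. -/
theorem isInvariant_rootRing (hF : F.Monic) [IsGalois (RatFunc ℚ) E]
    [FiniteDimensional (RatFunc ℚ) E] :
    Algebra.IsInvariant ℚ[X] (rootRing F E) (E ≃ₐ[RatFunc ℚ] E) where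
  isInvariant b hb := by
    have := isIntegral_rootRing (E := E) hF
    obtain ⟨k, hk⟩ := (IsGalois.mem_range_algebraMap_iff_fixed (F := RatFunc ℚ) (b : E)).mpr
      fun σ => congrArg Subtype.val (hb σ)
    have hinteg : IsIntegral ℚ[X] k := by
      rw [← isIntegral_algebraMap_iff (algebraMap (RatFunc ℚ) E).injective, hk]
      exact (Algebra.IsIntegral.isIntegral b).map (rootRing F E).val
    obtain ⟨a, rfl⟩ := IsIntegrallyClosed.isIntegral_iff.mp hinteg
    refine ⟨a, Subtype.ext ?_⟩
    rw [← hk, ← IsScalarTower.algebraMap_apply]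
    rfl

/-- The specialization `t ↦ c` extends to the ring generated by the roots of `F`, with image the
splitting field of `F(c, x)`. -/
theorem exists_rootRing_hom (hF : F.Monic)
    [(overRatFunc F).IsSplittingField (RatFunc ℚ) E] (c : ℤ) :
    ∃ π : rootRing F E →+* splittingFieldRat (specialize F c), Function.Surjective π ∧
      ∀ a : ℚ[X], π (algebraMap _ _ a) = algebraMap ℚ _ (a.eval (c : ℚ)) := by
  have := isIntegral_rootRing (E := E) hF
  have : FaithfulSMul ℚ[X] (rootRing F E) := by
    rw [faithfulSMul_iff_algebraMap_injective]
    exact Function.Injective.of_comp (f := (rootRing F E).val) algebraMap_polynomial_injective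
  obtain ⟨π, hπ⟩ := exists_ringHom_extension (B := rootRing F E)
    ((algebraMap ℚ (AlgebraicClosure ℚ)).comp (evalRingHom (c : ℚ)))
  have hπa : ∀ a : ℚ[X], π (algebraMap _ _ a) = algebraMap ℚ _ (a.eval (c : ℚ)) :=
    fun a => RingHom.congr_fun hπ a
  let j : ℤ[X] →+* rootRing F E :=
    (algebraMap ℚ[X] (rootRing F E)).comp (mapRingHom (Int.castRingHom ℚ))
  have hjval : ((rootRing F E).val : rootRing F E →+* E).comp j = intPolyHom E := by
    refine RingHom.ext fun a => ?_
    simp only [j, intPolyHom, RingHom.comp_apply]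
    rw [← IsScalarTower.algebraMap_apply]
    rfl
  have hπj : π.comp j = (Int.castRingHom _).comp (evalRingHom c) := by
    apply Polynomial.ringHom_ext
    · intro a; simp [j]
    · simp [j, hπa]
  -- the roots of `F(c, x)` are the images of the roots of `F`
  obtain ⟨s, hs, hsF⟩ : ∃ s : Multiset (rootRing F E),
      (∀ b ∈ s, (b : E) ∈ (overRatFunc F).rootSet E) ∧
        F.map j = (s.map fun b => X - C b).prod := by
    have hsplit := IsSplittingField.splits E (overRatFunc F)
    have hm : ∀ x ∈ ((overRatFunc F).map (algebraMap (RatFunc ℚ) E)).roots,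
        x ∈ (overRatFunc F).rootSet E := by
      intro x hx
      rw [mem_rootSet]
      have h0 := (mem_roots'.mp hx)
      refine ⟨(overRatFunc_monic hF).ne_zero, ?_⟩
      rw [aeval_def, ← eval_map]; exact h0.2
    let s : Multiset (rootRing F E) :=
      ((overRatFunc F).map (algebraMap (RatFunc ℚ) E)).roots.pmap
        (fun x hx => ⟨x, Algebra.subset_adjoin hx⟩) hm
    have hsval : s.map Subtype.val = ((overRatFunc F).map (algebraMap (RatFunc ℚ) E)).roots := by
      rw [Multiset.map_pmap, Multiset.pmap_eq_map, Multiset.map_id']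
    refine ⟨s, ?_, ?_⟩
    · intro b hb
      refine hm _ ?_
      rw [← hsval]
      exact Multiset.mem_map_of_mem _ hb
    · refine map_injective ((rootRing F E).val : rootRing F E →+* E) Subtype.val_injective ?_
      rw [Polynomial.map_map, hjval, ← map_overRatFunc,
        hsplit.eq_prod_roots_of_monic ((overRatFunc_monic hF).map _), Polynomial.map_multiset_prod,
        ← hsval, Multiset.map_map, Multiset.map_map]
      simp
  -- The factorization of F into linear factors already holds over the root ring, so π carries it to
  -- one of F(c, x): the roots of F(c, x) are exactly the images of generic roots.
  have hprod : (specialize F c).map (Int.castRingHom (AlgebraicClosure ℚ)) =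
      (s.map fun b => X - C (π b)).prod := by
    rw [specialize, Polynomial.map_map, ← hπj, ← Polynomial.map_map, hsF,
      Polynomial.map_multiset_prod, Multiset.map_map]
    simp
  have hmem : ∀ b : rootRing F E, (b : E) ∈ (overRatFunc F).rootSet E →
      π b ∈ (specialize F c).rootSet (AlgebraicClosure ℚ) := by
    intro b hb
    rw [mem_rootSet]
    refine ⟨(specialize_monic hF c).ne_zero, ?_⟩
    have h1 : F.eval₂ j b = 0 := by
      refine Subtype.val_injective ?_
      have h2 := (mem_rootSet.mp hb).2
      rw [aeval_def, ← eval_map, map_overRatFunc, eval_map, ← hjval] at h2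
      have h3 := hom_eval₂ F j ((rootRing F E).val : rootRing F E →+* E) b
      exact h3.trans h2
    have h4 := hom_eval₂ F j π b
    rw [h1, map_zero, hπj] at h4
    rw [aeval_def, specialize, eval₂_map]
    exact h4.symm
  have hrange : ∀ b, π b ∈ splittingFieldRat (specialize F c) := by
    rintro ⟨b, hb⟩
    induction hb using Algebra.adjoin_induction with
    | mem x hx => exact IntermediateField.subset_adjoin _ _ (hmem _ hx)
    | algebraMap r =>
      have := hπa r
      exact this ▸ IntermediateField.algebraMap_mem _ _
    | add x y hx hy h1 h2 =>
      have := map_add π ⟨x, hx⟩ ⟨y, hy⟩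
      exact this ▸ add_mem h1 h2
    | mul x y hx hy h1 h2 =>
      have := map_mul π ⟨x, hx⟩ ⟨y, hy⟩
      exact this ▸ mul_mem h1 h2
  refine ⟨π.codRestrict (splittingFieldRat (specialize F c)) hrange, ?_, fun a =>
    Subtype.ext (hπa a)⟩
  rintro ⟨x, hx⟩
  suffices h : ∃ b, π b = x by
    obtain ⟨b, hb⟩ := h
    exact ⟨b, Subtype.ext hb⟩
  have halg : ∀ x ∈ (specialize F c).rootSet (AlgebraicClosure ℚ), IsAlgebraic ℚ x :=
    fun x _ => Algebra.IsAlgebraic.isAlgebraic x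
  rw [splittingFieldRat, ← IntermediateField.mem_toSubalgebra,
    IntermediateField.adjoin_toSubalgebra_of_isAlgebraic halg] at hx
  induction hx using Algebra.adjoin_induction with
  | mem x hx =>
    have h1 := (mem_rootSet.mp hx).2
    rw [aeval_def, ← eval_map] at h1
    have h2 : ((s.map fun b => X - C (π b)).prod).eval x = 0 := by rw [← hprod]; exact h1
    rw [eval_multiset_prod, Multiset.prod_eq_zero_iff, Multiset.map_map, Multiset.mem_map] at h2
    obtain ⟨b, -, hb⟩ := h2
    refine ⟨b, ?_⟩
    simp only [Function.comp_apply, eval_sub, eval_X, eval_C] at hb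
    exact (sub_eq_zero.mp hb).symm
  | algebraMap r => exact ⟨algebraMap _ _ (C r), by rw [hπa, eval_C]⟩
  | add x y _ _ h1 h2 =>
    obtain ⟨a, rfl⟩ := h1
    obtain ⟨b, rfl⟩ := h2
    exact ⟨a + b, map_add _ _ _⟩
  | mul x y _ _ h1 h2 =>
    obtain ⟨a, rfl⟩ := h1
    obtain ⟨b, rfl⟩ := h2
    exact ⟨a * b, map_mul _ _ _⟩

/-- Every automorphism of the specialized splitting field is induced by an element of the
decomposition group. -/
theorem exists_lift_of_rootRing_hom (hF : F.Monic)
    [(overRatFunc F).IsSplittingField (RatFunc ℚ) E] {c : ℤ}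
    {π : rootRing F E →+* splittingFieldRat (specialize F c)} (hπ : Function.Surjective π)
    (hπa : ∀ a : ℚ[X], π (algebraMap _ _ a) = algebraMap ℚ _ (a.eval (c : ℚ)))
    (τ : splittingFieldRat (specialize F c) ≃ₐ[ℚ] splittingFieldRat (specialize F c)) :
    ∃ σ : E ≃ₐ[RatFunc ℚ] E, ∀ b, π (σ • b) = τ (π b) := by
  have := isGalois_of_isSplittingField F E
  have : FiniteDimensional (RatFunc ℚ) E := IsSplittingField.finiteDimensional _ (overRatFunc F)
  have := isInvariant_rootRing (E := E) hF
  let P : Ideal ℚ[X] := RingHom.ker (evalRingHom (c : ℚ))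
  let M : Ideal (rootRing F E) := RingHom.ker π
  have hM : M.IsPrime := RingHom.ker_isPrime π
  have hMP : M.LiesOver P := ⟨by
    ext a
    rw [Ideal.mem_comap, RingHom.mem_ker, RingHom.mem_ker, hπa, coe_evalRingHom]
    exact (map_eq_zero_iff _ (algebraMap ℚ _).injective).symm⟩
  let e : (rootRing F E ⧸ M) ≃+* splittingFieldRat (specialize F c) :=
    RingHom.quotientKerEquivOfSurjective hπ
  have he : ∀ b, e (Ideal.Quotient.mk M b) = π b := fun b =>
    RingHom.quotientKerEquivOfSurjective_apply_mk hπ b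
  -- The residue ring at ker π is the splitting field of F(c, x); τ is transported there so that
  -- surjectivity of the stabilizer onto residue automorphisms applies.
  let τ' : (rootRing F E ⧸ M) ≃ₐ[ℚ[X] ⧸ P] (rootRing F E ⧸ M) :=
    AlgEquiv.ofRingEquiv (f := (e.trans τ.toRingEquiv).trans e.symm) fun r => by
      obtain ⟨a, rfl⟩ := Ideal.Quotient.mk_surjective r
      have h1 : algebraMap (ℚ[X] ⧸ P) (rootRing F E ⧸ M) (Ideal.Quotient.mk P a) =
          Ideal.Quotient.mk M (algebraMap _ _ a) := rfl
      rw [h1, RingEquiv.trans_apply, RingEquiv.trans_apply, RingEquiv.symm_apply_eq, he, hπa]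
      exact τ.commutes _
  obtain ⟨σ, hσ⟩ := Ideal.Quotient.stabilizerHom_surjective (E ≃ₐ[RatFunc ℚ] E) P M τ'
  refine ⟨σ, fun b => ?_⟩
  have h2 := AlgEquiv.congr_fun hσ (Ideal.Quotient.mk M b)
  have h3 : τ' (Ideal.Quotient.mk M b) = e.symm (τ (π b)) := by
    rw [← he]; rfl
  rw [h3, RingEquiv.eq_symm_apply] at h2
  rw [← h2, ← he]
  rfl

end RootRing

theorem rootSet_map_intCast (g : ℤ[X]) :
    (g.map (Int.castRingHom ℚ)).rootSet (AlgebraicClosure ℚ) =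
      g.rootSet (AlgebraicClosure ℚ) := by
  have h : (g.map (Int.castRingHom ℚ)).map (algebraMap ℚ (AlgebraicClosure ℚ)) =
      g.map (algebraMap ℤ (AlgebraicClosure ℚ)) := by
    rw [Polynomial.map_map]
    congr 1
  simp only [rootSet, aroots, h]

instance isSplittingField_splittingFieldRat (g : ℤ[X]) :
    (g.map (Int.castRingHom ℚ)).IsSplittingField ℚ (splittingFieldRat g) := by
  rw [splittingFieldRat, ← rootSet_map_intCast]
  exact IntermediateField.adjoin_rootSet_isSplittingField (IsAlgClosed.splits _)

instance finiteDimensional_splittingFieldRat (g : ℤ[X]) :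
    FiniteDimensional ℚ (splittingFieldRat g) :=
  IsSplittingField.finiteDimensional _ (g.map (Int.castRingHom ℚ))

instance isGalois_splittingFieldRat (g : ℤ[X]) : IsGalois ℚ (splittingFieldRat g) :=
  have : Normal ℚ (splittingFieldRat g) := Normal.of_isSplittingField (g.map (Int.castRingHom ℚ))
  { }

/-! ### Hilbert irreducibility for Galois groups -/

section Specialization

variable {F : ℤ[X][X]} {E : Type*} [Field E] [Algebra (RatFunc ℚ) E] [Algebra ℚ[X] E]
  [IsScalarTower ℚ[X] (RatFunc ℚ) E]

/-- Denominators are cleared by induction, because E is generated as a ring over ℚ(t) by the roots,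
and these are integral over ℤ[t]. -/
theorem exists_int_mul_mem_rootRing (hF : F.Monic)
    [(overRatFunc F).IsSplittingField (RatFunc ℚ) E] (e : E) :
    ∃ a : ℤ[X], a ≠ 0 ∧ intPolyHom E a * e ∈ rootRing F E ∧
      (intPolyHom E).IsIntegralElem (intPolyHom E a * e) := by
  have hmem : ∀ a : ℤ[X], intPolyHom E a ∈ rootRing F E := by
    intro a
    have : intPolyHom E a = algebraMap ℚ[X] E (a.map (Int.castRingHom ℚ)) := by
      rw [IsScalarTower.algebraMap_apply ℚ[X] (RatFunc ℚ) E]; rfl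
    rw [this]
    exact Subalgebra.algebraMap_mem _ _
  have he : e ∈ Algebra.adjoin (RatFunc ℚ) ((overRatFunc F).rootSet E) := by
    rw [IsSplittingField.adjoin_rootSet]; trivial
  induction he using Algebra.adjoin_induction with
  | mem x hx =>
    refine ⟨1, one_ne_zero, ?_, ?_⟩ <;> rw [map_one, one_mul]
    · exact Algebra.subset_adjoin hx
    · refine ⟨F, hF, ?_⟩
      have := (mem_rootSet.mp hx).2
      rwa [aeval_def, ← eval_map, map_overRatFunc, eval_map] at this
  | algebraMap r =>
    obtain ⟨x, y, hy, hxy⟩ := ratFunc_exists_int_div r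
    have : intPolyHom E y * algebraMap (RatFunc ℚ) E r = intPolyHom E x := by
      have := congrArg (algebraMap (RatFunc ℚ) E) hxy
      rw [map_mul, mul_comm] at this
      exact this
    refine ⟨y, hy, ?_⟩
    rw [this]
    exact ⟨hmem x, RingHom.isIntegralElem_map _⟩
  | add x y _ _ hx hy =>
    obtain ⟨a, ha0, ha, ha'⟩ := hx
    obtain ⟨b, hb0, hb, hb'⟩ := hy
    have : intPolyHom E (a * b) * (x + y) =
        intPolyHom E b * (intPolyHom E a * x) + intPolyHom E a * (intPolyHom E b * y) := by
      rw [map_mul]; ring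
    refine ⟨a * b, mul_ne_zero ha0 hb0, ?_⟩
    rw [this]
    exact ⟨add_mem (mul_mem (hmem b) ha) (mul_mem (hmem a) hb),
      RingHom.IsIntegralElem.add _ (RingHom.IsIntegralElem.mul _ (RingHom.isIntegralElem_map _) ha')
        (RingHom.IsIntegralElem.mul _ (RingHom.isIntegralElem_map _) hb')⟩
  | mul x y _ _ hx hy =>
    obtain ⟨a, ha0, ha, ha'⟩ := hx
    obtain ⟨b, hb0, hb, hb'⟩ := hy
    have : intPolyHom E (a * b) * (x * y) = (intPolyHom E a * x) * (intPolyHom E b * y) := by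
      rw [map_mul]; ring
    refine ⟨a * b, mul_ne_zero ha0 hb0, ?_⟩
    rw [this]
    exact ⟨mul_mem ha hb, RingHom.IsIntegralElem.mul _ ha' hb'⟩

/-- By the Galois correspondence a proper subgroup fixes more than ℚ(t); an element witnessing this
is scaled to be integral. Its specialization will be rational whenever the decomposition group lies
in H. -/
theorem exists_integral_generator (hF : F.Monic)
    [(overRatFunc F).IsSplittingField (RatFunc ℚ) E] (H : Subgroup (E ≃ₐ[RatFunc ℚ] E))
    (hH : H ≠ ⊤) :
    ∃ θ : rootRing F E, (∀ σ ∈ H, σ • θ = θ) ∧ (θ : E) ∉ (algebraMap (RatFunc ℚ) E).range ∧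
      (intPolyHom E).IsIntegralElem (θ : E) := by
  have := isGalois_of_isSplittingField F E
  have : FiniteDimensional (RatFunc ℚ) E := IsSplittingField.finiteDimensional _ (overRatFunc F)
  have hne : ¬ IntermediateField.fixedField H ≤ ⊥ := by
    intro hle
    refine hH ?_
    rw [← IntermediateField.fixingSubgroup_fixedField H, le_bot_iff.mp hle,
      IntermediateField.fixingSubgroup_bot]
  obtain ⟨e, heH, heK⟩ := SetLike.not_le_iff_exists.mp hne
  obtain ⟨a, ha0, hmem, hinteg⟩ := exists_int_mul_mem_rootRing (E := E) hF e
  have ha0' : intPolyHom E a ≠ 0 := (map_ne_zero_iff _ (intPolyHom_injective E)).mpr ha0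
  have haK : intPolyHom E a = algebraMap (RatFunc ℚ) E (intPolyHom (RatFunc ℚ) a) := rfl
  refine ⟨⟨_, hmem⟩, fun σ hσ => Subtype.ext ?_, ?_, hinteg⟩
  · have hσa : σ (intPolyHom E a) = intPolyHom E a := by rw [haK, σ.commutes]
    rw [coe_smul_rootRing, map_mul, hσa]
    congr 1
    exact heH ⟨σ, hσ⟩
  · rintro ⟨k, hk⟩
    refine heK (IntermediateField.mem_bot.mpr ⟨k / intPolyHom (RatFunc ℚ) a, ?_⟩)
    rw [map_div₀, hk, ← haK]
    exact mul_div_cancel_left₀ e ha0'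

theorem hom_eval₂_rootRing {c : ℤ} {π : rootRing F E →+* splittingFieldRat (specialize F c)}
    (hπa : ∀ a : ℚ[X], π (algebraMap _ _ a) = algebraMap ℚ _ (a.eval (c : ℚ)))
    {h : ℤ[X][X]} {θ : rootRing F E} (hθ : h.eval₂ (intPolyHom E) (θ : E) = 0) :
    (specialize h c).eval₂ (Int.castRingHom _) (π θ) = 0 := by
  let j : ℤ[X] →+* rootRing F E :=
    (algebraMap ℚ[X] (rootRing F E)).comp (mapRingHom (Int.castRingHom ℚ))
  have hjval : ((rootRing F E).val : rootRing F E →+* E).comp j = intPolyHom E := by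
    refine RingHom.ext fun a => ?_
    simp only [j, intPolyHom, RingHom.comp_apply]
    rw [← IsScalarTower.algebraMap_apply]
    rfl
  have hπj : π.comp j = (Int.castRingHom _).comp (evalRingHom c) := by
    apply Polynomial.ringHom_ext
    · intro a; simp [j]
    · simp [j, hπa]
  have h1 : h.eval₂ j θ = 0 := by
    refine Subtype.val_injective ?_
    rw [← hjval] at hθ
    exact (hom_eval₂ h j ((rootRing F E).val : rootRing F E →+* E) θ).trans hθ
  have h4 := hom_eval₂ h j π θ
  rw [h1, map_zero, hπj] at h4
  have h5 : specialize h c = h.map (evalRingHom c) := rfl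
  rw [h5, eval₂_map]
  exact h4.symm

theorem exists_int_root_of_eval₂_rat {g : ℤ[X]} (hg : g.Monic) {L : Type*} [Field L] [Algebra ℚ L]
    {q : ℚ} (hq : g.eval₂ (Int.castRingHom L) (algebraMap ℚ L q) = 0) :
    ∃ y : ℤ, g.eval y = 0 := by
  have h1 : g.eval₂ (algebraMap ℤ ℚ) q = 0 := by
    refine (algebraMap ℚ L).injective ?_
    rw [hom_eval₂, map_zero, ← hq]
    congr 1
    exact Subsingleton.elim _ _
  obtain ⟨y, rfl⟩ := IsIntegrallyClosed.isIntegral_iff.mp (⟨g, hg, h1⟩ : IsIntegral ℤ q)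
  refine ⟨y, (algebraMap ℤ ℚ).injective_int ?_⟩
  rw [eval₂_hom] at h1
  rw [h1, map_zero]

/-- The order of the Galois group does not grow under specialization, and if it is preserved then
so is the group. -/
theorem card_gal_specialize_le (hF : F.Monic) [(overRatFunc F).IsSplittingField (RatFunc ℚ) E]
    (c : ℤ) :
    Nat.card (splittingFieldRat (specialize F c) ≃ₐ[ℚ] splittingFieldRat (specialize F c)) ≤
        Nat.card (E ≃ₐ[RatFunc ℚ] E) ∧
    (Nat.card (splittingFieldRat (specialize F c) ≃ₐ[ℚ] splittingFieldRat (specialize F c)) =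
        Nat.card (E ≃ₐ[RatFunc ℚ] E) →
      Nonempty ((splittingFieldRat (specialize F c) ≃ₐ[ℚ] splittingFieldRat (specialize F c)) ≃*
        (E ≃ₐ[RatFunc ℚ] E))) := by
  have : FiniteDimensional (RatFunc ℚ) E := IsSplittingField.finiteDimensional _ (overRatFunc F)
  obtain ⟨π, hπ, hπa⟩ := exists_rootRing_hom (E := E) hF c
  choose g hg using exists_lift_of_rootRing_hom hF hπ hπa
  have huniq : ∀ τ τ' : splittingFieldRat (specialize F c) ≃ₐ[ℚ] splittingFieldRat (specialize F c),
      (∀ b, τ (π b) = τ' (π b)) → τ = τ' := by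
    intro τ τ' h
    ext1 x
    obtain ⟨b, rfl⟩ := hπ x
    exact h b
  have hinj : Function.Injective g := fun τ τ' h => huniq _ _ fun b => by rw [← hg, ← hg, h]
  refine ⟨Nat.card_le_card_of_injective g hinj, fun hcard => ?_⟩
  have hbij : Function.Bijective g :=
    (Nat.bijective_iff_injective_and_card g).mpr ⟨hinj, hcard⟩
  let e := Equiv.ofBijective g hbij
  -- The lifts g were chosen arbitrarily, so multiplicativity is checked for the inverse: the
  -- automorphism induced by a lift is determined by it, as π is surjective.
  refine ⟨(MulEquiv.mk' e.symm fun σ σ' => huniq _ _ fun b => ?_).symm⟩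
  obtain ⟨τ, rfl⟩ := e.surjective σ
  obtain ⟨τ', rfl⟩ := e.surjective σ'
  have h1 := hg (e.symm (e τ * e τ')) b
  rw [show g (e.symm (e τ * e τ')) = e τ * e τ' from e.apply_symm_apply _, mul_smul] at h1
  rw [← h1, e.symm_apply_apply, e.symm_apply_apply, AlgEquiv.mul_apply, ← hg τ' b]
  exact hg τ _

/-- **Hilbert's irreducibility theorem** for Galois groups, in an arithmetic progression. -/
theorem exists_card_gal_specialize_eq (hF : F.Monic)
    [(overRatFunc F).IsSplittingField (RatFunc ℚ) E] (a b : ℤ) (hb : b ≠ 0) (Z : Set ℤ)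
    (hZ : Z.Finite) :
    ∃ k : ℤ, a + b * k ∉ Z ∧
      Nat.card (splittingFieldRat (specialize F (a + b * k)) ≃ₐ[ℚ]
        splittingFieldRat (specialize F (a + b * k))) = Nat.card (E ≃ₐ[RatFunc ℚ] E) := by
  have := isGalois_of_isSplittingField F E
  have : FiniteDimensional (RatFunc ℚ) E := IsSplittingField.finiteDimensional _ (overRatFunc F)
  have := isIntegral_rootRing (E := E) hF
  choose θ hθH hθK hθint using fun H : {H : Subgroup (E ≃ₐ[RatFunc ℚ] E) // H ≠ ⊤} =>
    exists_integral_generator hF H.1 H.2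
  choose h hmon hroot hsep hrat using fun H => exists_integral_minpoly (hθint H) (hθK H)
  -- For σ ≠ 1 some root x is moved, and the nonzero integral element σx - x divides some r(t) ≠ 0.
  -- At any c with r(c) ≠ 0, π separates σx from x, so σ is not in the inertia group of π.
  have hram : ∀ σ : {σ : E ≃ₐ[RatFunc ℚ] E // σ ≠ 1}, ∃ x : rootRing F E, ∃ r : ℚ[X], r ≠ 0 ∧
      (σ.1 • x - x) ∣ algebraMap ℚ[X] (rootRing F E) r := by
    rintro ⟨σ, hσ⟩
    obtain ⟨x, hx, hxσ⟩ : ∃ x ∈ (overRatFunc F).rootSet E, σ x ≠ x := by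
      by_contra hcon
      push Not at hcon
      refine hσ (AlgEquiv.ext fun e => ?_)
      have he : e ∈ Algebra.adjoin (RatFunc ℚ) ((overRatFunc F).rootSet E) := by
        rw [IsSplittingField.adjoin_rootSet]; trivial
      exact AlgHom.congr_fun (AlgHom.ext_of_adjoin_eq_top (IsSplittingField.adjoin_rootSet E
        (overRatFunc F)) (φ₁ := σ.toAlgHom) (φ₂ := AlgHom.id _ _) hcon) e
    refine ⟨⟨x, Algebra.subset_adjoin hx⟩, ?_⟩
    refine (Algebra.IsIntegral.isIntegral _).isAlgebraic.exists_nonzero_dvd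
      (mem_nonZeroDivisors_of_ne_zero fun h0 => hxσ ?_)
    exact sub_eq_zero.mp (congrArg Subtype.val h0)
  choose x r hr0 hr using hram
  have hbad : (⋃ σ, {c : ℤ | (r σ).eval (c : ℚ) = 0}).Finite := by
    refine Set.finite_iUnion fun σ => ?_
    exact Set.Finite.preimage (f := fun c : ℤ => (c : ℚ)) Int.cast_injective.injOn
      (finite_setOfPred_isRoot (hr0 σ))
  obtain ⟨k, hkZ, hk⟩ := exists_mem_progression_forall_no_root h hmon hsep hrat a b hb _
    (hZ.union hbad)
  refine ⟨k, fun hmem => hkZ (Or.inl hmem), ?_⟩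
  have hkr : ∀ σ, (r σ).eval ((a + b * k : ℤ) : ℚ) ≠ 0 := fun σ h0 =>
    hkZ (Or.inr (Set.mem_iUnion.mpr ⟨σ, h0⟩))
  generalize a + b * k = c at hk hkr
  obtain ⟨π, hπ, hπa⟩ := exists_rootRing_hom (E := E) hF c
  choose g hg using exists_lift_of_rootRing_hom hF hπ hπa
  have hinj : Function.Injective g := by
    intro τ τ' hττ
    ext1 y
    obtain ⟨b, rfl⟩ := hπ y
    rw [← hg, ← hg, hττ]
  -- D is the decomposition group of ker π.
  let D : Subgroup (E ≃ₐ[RatFunc ℚ] E) :=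
    { carrier := {σ | ∃ τ : splittingFieldRat (specialize F c) ≃ₐ[ℚ]
        splittingFieldRat (specialize F c), ∀ b, π (σ • b) = τ (π b)}
      one_mem' := ⟨1, fun b => by rw [one_smul, AlgEquiv.one_apply]⟩
      mul_mem' := by
        rintro σ σ' ⟨τ, hτ⟩ ⟨τ', hτ'⟩
        exact ⟨τ * τ', fun b => by rw [mul_smul, hτ, hτ', AlgEquiv.mul_apply]⟩
      inv_mem' := by
        rintro σ ⟨τ, hτ⟩
        refine ⟨τ⁻¹, fun b => τ.injective ?_⟩
        rw [← hτ, smul_inv_smul, ← AlgEquiv.mul_apply, mul_inv_cancel, AlgEquiv.one_apply] }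
  have hD : D = ⊤ := by
    by_contra hD
    -- If D is proper, π(θ) for the θ attached to D is fixed by Gal(K_c/ℚ), hence rational and
    -- integral over ℤ: an integral point above c on the curve of θ, which c was chosen to avoid.
    have hfix : ∀ τ : splittingFieldRat (specialize F c) ≃ₐ[ℚ] splittingFieldRat (specialize F c),
        τ (π (θ ⟨D, hD⟩)) = π (θ ⟨D, hD⟩) := by
      intro τ
      rw [← hg, hθH ⟨D, hD⟩ _ ⟨τ, hg τ⟩]
    obtain ⟨q, hq⟩ := (IsGalois.mem_range_algebraMap_iff_fixed (F := ℚ) _).mpr hfix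
    have h1 := hom_eval₂_rootRing hπa (hroot ⟨D, hD⟩)
    rw [← hq] at h1
    obtain ⟨y, hy⟩ := exists_int_root_of_eval₂_rat (specialize_monic (hmon ⟨D, hD⟩) c) h1
    exact hk ⟨D, hD⟩ y hy
  have hsurj : Function.Surjective g := by
    intro σ
    obtain ⟨τ, hτ⟩ : σ ∈ D := hD ▸ Subgroup.mem_top σ
    refine ⟨τ, ?_⟩
    by_contra hne
    -- Two lifts of the same τ differ by an inertia element, and inertia is trivial because r(c) ≠
    -- 0.
    have hne' : g τ * σ⁻¹ ≠ 1 := fun h => hne (mul_inv_eq_one.mp h)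
    obtain ⟨z, hz⟩ := hr ⟨_, hne'⟩
    refine hkr ⟨_, hne'⟩ ((algebraMap ℚ (splittingFieldRat (specialize F c))).injective ?_)
    rw [← hπa, hz, map_mul, map_sub, mul_smul, hg, ← hτ, smul_inv_smul, sub_self, zero_mul, map_zero]
  exact Nat.card_congr (Equiv.ofBijective g ⟨hinj, hsurj⟩)

end Specialization

/-! ### Regular extensions and composita of specializations -/

/-- If `k` is algebraically closed in `R` then minimal polynomials do not shrink from `k` to `R`. -/
theorem natDegree_minpoly_le_of_algebraicClosure_eq_bot {k R E : Type*} [Field k] [Field R]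
    [Field E] [Algebra k R] [Algebra R E] [Algebra k E] [IsScalarTower k R E]
    (hreg : algebraicClosure k R = ⊥) {μ : E} (hμ : IsIntegral k μ) :
    (minpoly k μ).natDegree ≤ (minpoly R μ).natDegree := by
  have hR : IsIntegral R μ := hμ.tower_top
  -- A monic factor over R of a monic polynomial over k has coefficients integral over k; these lie
  -- in k, so the factor is defined over k.
  have h1 := integralClosure.mem_lifts_of_monic_of_dvd_map R (minpoly.monic hμ) (minpoly.monic hR)
    (minpoly.dvd_map_of_isScalarTower k R μ)
  have h2 : minpoly R μ ∈ lifts (algebraMap k R) := by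
    rw [lifts_iff_coeff_lifts] at h1 ⊢
    intro n
    obtain ⟨z, hz⟩ := h1 n
    have hz' : (z : R) ∈ algebraicClosure k R :=
      mem_algebraicClosure_iff.mpr (IsIntegral.isAlgebraic z.2)
    rw [hreg] at hz'
    rw [← hz]
    exact IntermediateField.mem_bot.mp hz'
  obtain ⟨g, hg, hgd, hgm⟩ := lifts_and_natDegree_eq_and_monic h2 (minpoly.monic hR)
  rw [← hgd]
  refine natDegree_le_of_dvd (minpoly.dvd k μ ?_) hgm.ne_zero
  rw [← aeval_map_algebraMap R, hg, minpoly.aeval]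

/-- A primitive element of L keeps its full degree over the regular extension R, so [E : R] ≥ [L :
ℚ]; then the tower law applies. -/
theorem finrank_mul_le_of_isRegularOverRat {K R E L : Type*} [Field K] [Field R] [Field E]
    [Field L] [Algebra K R] [Algebra K E] [Algebra R E] [IsScalarTower K R E]
    [FiniteDimensional K E] [Algebra ℚ R] (hreg : IsRegularOverRat R) [Algebra ℚ E]
    [IsScalarTower ℚ R E] [Algebra ℚ L] [FiniteDimensional ℚ L] (ψ : L →ₐ[ℚ] E) :
    Module.finrank K R * Module.finrank ℚ L ≤ Module.finrank K E := by
  have : FiniteDimensional K R := FiniteDimensional.left K R E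
  have : FiniteDimensional R E := FiniteDimensional.right K R E
  have := Module.finrank_mul_finrank K R E
  rw [← this]
  refine Nat.mul_le_mul_left _ ?_
  have : CharZero L := algebraRat.charZero L
  obtain ⟨lam, hlam⟩ := Field.exists_primitive_element ℚ L
  have hinteg : IsIntegral ℚ lam := Algebra.IsIntegral.isIntegral lam
  have h1 : Module.finrank ℚ L = (minpoly ℚ (ψ lam)).natDegree := by
    rw [minpoly.algHom_eq ψ ψ.injective, ← IntermediateField.adjoin.finrank hinteg, hlam,
      IntermediateField.finrank_top']
  rw [h1]
  exact (natDegree_minpoly_le_of_algebraicClosure_eq_bot hreg (hinteg.map ψ)).trans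
    (minpoly.natDegree_le _)

theorem splittingFieldRat_mul {g h : ℤ[X]} (hg : g ≠ 0) (hh : h ≠ 0) :
    splittingFieldRat (g * h) = splittingFieldRat g ⊔ splittingFieldRat h := by
  rw [splittingFieldRat, splittingFieldRat, splittingFieldRat, ← IntermediateField.adjoin_union]
  congr 1
  ext x
  simp only [Set.mem_union, mem_rootSet, map_mul, mul_eq_zero, ne_eq]
  tauto

theorem splittingFieldRat_one : splittingFieldRat 1 = ⊥ := by
  rw [splittingFieldRat, rootSet_one, IntermediateField.adjoin_empty]

theorem specialize_mul_map_C (f : ℤ[X][X]) (l : ℤ[X]) (c : ℤ) :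
    specialize (f * l.map (C : ℤ →+* ℤ[X])) c = specialize f c * l := by
  rw [specialize, Polynomial.map_mul, Polynomial.map_map]
  have : (evalRingHom c).comp (C : ℤ →+* ℤ[X]) = RingHom.id ℤ := RingHom.ext fun x => by simp
  rw [this, Polynomial.map_id, specialize]

/-- The compositum of the splitting fields of the specializations of `f` at the elements of `s`. -/
def specializationCompositum (f : ℤ[X][X]) (s : Finset ℤ) :
    IntermediateField ℚ (AlgebraicClosure ℚ) :=
  splittingFieldRat (∏ c ∈ s, specialize f c)

/-- The order of the Galois group of `f` over `ℚ(t)`. -/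
def genericOrder (f : ℤ[X][X]) : ℕ := Nat.card (overRatFunc f).Gal

/-! ### Linearly disjoint families of specializations -/

section Family

variable {f : ℤ[X][X]}

instance (s : Finset ℤ) : FiniteDimensional ℚ (specializationCompositum f s) :=
  finiteDimensional_splittingFieldRat _

theorem specializationCompositum_insert (hf : f.Monic) {s : Finset ℤ} {c : ℤ} (hc : c ∉ s) :
    specializationCompositum f (insert c s) =
      splittingFieldRat (specialize f c) ⊔ specializationCompositum f s := by
  rw [specializationCompositum, Finset.prod_insert hc, splittingFieldRat_mul
    (specialize_monic hf c).ne_zero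
    (Finset.prod_ne_zero_iff.mpr fun i _ => (specialize_monic hf i).ne_zero),
    specializationCompositum]

theorem splittingFieldRat_le_specializationCompositum (hf : f.Monic) {s : Finset ℤ} {c : ℤ}
    (hc : c ∈ s) : splittingFieldRat (specialize f c) ≤ specializationCompositum f s := by
  rw [← Finset.insert_erase hc, specializationCompositum_insert hf (Finset.notMem_erase c s)]
  exact le_sup_left

theorem specializationCompositum_mono (hf : f.Monic) {s t : Finset ℤ} (hst : s ⊆ t) :
    specializationCompositum f s ≤ specializationCompositum f t := by
  induction s using Finset.induction_on with
  | empty =>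
    rw [specializationCompositum, Finset.prod_empty, splittingFieldRat_one]
    exact bot_le
  | insert c s hc ih =>
    rw [specializationCompositum_insert hf hc]
    exact sup_le (splittingFieldRat_le_specializationCompositum hf (hst (Finset.mem_insert_self c s)))
      (ih ((Finset.subset_insert c s).trans hst))

theorem finrank_splittingFieldRat_le (hf : f.Monic) (c : ℤ) :
    Module.finrank ℚ (splittingFieldRat (specialize f c)) ≤ genericOrder f := by
  rw [← IsGalois.card_aut_eq_finrank]
  exact (card_gal_specialize_le (E := (overRatFunc f).SplittingField) hf c).1

theorem finrank_specializationCompositum_le (hf : f.Monic) (s : Finset ℤ) :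
    Module.finrank ℚ (specializationCompositum f s) ≤ genericOrder f ^ s.card := by
  induction s using Finset.induction_on with
  | empty =>
    rw [specializationCompositum, Finset.prod_empty, splittingFieldRat_one,
      IntermediateField.finrank_bot]
    simp
  | insert c s hc ih =>
    rw [specializationCompositum_insert hf hc, Finset.card_insert_of_notMem hc, pow_succ']
    exact (IntermediateField.finrank_sup_le _ _).trans
      (Nat.mul_le_mul (finrank_splittingFieldRat_le hf c) ih)

/-- Both the splitting field R of f over ℚ(t) and the splitting field of l over ℚ embed in E, so
regularity of R bounds the degree of E from below. -/
theorem finrank_mul_le_of_isSplittingField (hf : f.Monic) {l : ℤ[X]} (hl : l.Monic)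
    {R E : Type*} [Field R] [Algebra (RatFunc ℚ) R] [(overRatFunc f).IsSplittingField (RatFunc ℚ) R]
    [Algebra ℚ R] (hreg : IsRegularOverRat R) [Field E] [Algebra (RatFunc ℚ) E]
    [(overRatFunc (f * l.map (C : ℤ →+* ℤ[X]))).IsSplittingField (RatFunc ℚ) E] [Algebra ℚ E] :
    Module.finrank (RatFunc ℚ) R * Module.finrank ℚ (splittingFieldRat l) ≤
      Module.finrank (RatFunc ℚ) E := by
  have hF : (f * l.map (C : ℤ →+* ℤ[X])).Monic := hf.mul (hl.map _)
  have hsplit := IsSplittingField.splits E (overRatFunc (f * l.map (C : ℤ →+* ℤ[X])))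
  have hne : (overRatFunc (f * l.map (C : ℤ →+* ℤ[X]))).map (algebraMap (RatFunc ℚ) E) ≠ 0 :=
    ((overRatFunc_monic hF).map _).ne_zero
  have hmul : overRatFunc (f * l.map (C : ℤ →+* ℤ[X])) = overRatFunc f * overRatFunc (l.map (C : ℤ →+* ℤ[X])) := by
    simp only [overRatFunc, overRat, Polynomial.map_mul]
  have hsplitf : ((overRatFunc f).map (algebraMap (RatFunc ℚ) E)).Splits :=
    hsplit.of_dvd hne (Polynomial.map_dvd _ (Dvd.intro _ hmul.symm))
  have hsplitl : ((l.map (Int.castRingHom ℚ)).map (algebraMap ℚ E)).Splits := by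
    have h1 : ((overRatFunc (l.map (C : ℤ →+* ℤ[X]))).map (algebraMap (RatFunc ℚ) E)).Splits :=
      hsplit.of_dvd hne (Polynomial.map_dvd _ (Dvd.intro_left _ hmul.symm))
    rw [map_overRatFunc, Polynomial.map_map] at h1
    rw [Polynomial.map_map, Subsingleton.elim ((algebraMap ℚ E).comp (Int.castRingHom ℚ))
      ((intPolyHom E).comp C)]
    exact h1
  let ψ : splittingFieldRat l →ₐ[ℚ] E :=
    IsSplittingField.lift _ (l.map (Int.castRingHom ℚ)) hsplitl
  let φ : R →ₐ[RatFunc ℚ] E := IsSplittingField.lift _ (overRatFunc f) hsplitf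
  let : Algebra R E := φ.toRingHom.toAlgebra
  have : IsScalarTower (RatFunc ℚ) R E :=
    IsScalarTower.of_algebraMap_eq fun x => (φ.commutes x).symm
  have : IsScalarTower ℚ R E := IsScalarTower.of_algebraMap_eq' (Subsingleton.elim _ _)
  have : FiniteDimensional (RatFunc ℚ) E :=
    IsSplittingField.finiteDimensional _ (overRatFunc (f * l.map (C : ℤ →+* ℤ[X])))
  exact finrank_mul_le_of_isRegularOverRat hreg ψ

/-- Hilbert irreducibility is applied to f·l, where l is the product of the f(c, x) for c in s and
is constant in t. Specializing f·l at a new c gives the compositum of K_c with the old fields, in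
full generic degree. -/
theorem exists_specialization_finrank_ge (hf : f.Monic)
    (hreg : IsRegularOverRat (overRatFunc f).SplittingField) (a b : ℤ) (hb : b ≠ 0)
    (s : Finset ℤ) :
    ∃ k : ℤ, a + b * k ∉ s ∧ genericOrder f * Module.finrank ℚ (specializationCompositum f s) ≤
      Module.finrank ℚ (specializationCompositum f (insert (a + b * k) s)) := by
  have hlm : (∏ c ∈ s, specialize f c).Monic :=
    monic_prod_of_monic _ _ fun c _ => specialize_monic hf c
  obtain ⟨k, hk, hcard⟩ := exists_card_gal_specialize_eq
    (E := (overRatFunc (f * (∏ c ∈ s, specialize f c).map (C : ℤ →+* ℤ[X]))).SplittingField)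
    (hf.mul (hlm.map (C : ℤ →+* ℤ[X]))) a b hb s s.finite_toSet
  refine ⟨k, hk, ?_⟩
  have hle := finrank_mul_le_of_isSplittingField hf hlm hreg
    (E := (overRatFunc (f * (∏ c ∈ s, specialize f c).map (C : ℤ →+* ℤ[X]))).SplittingField)
  have hgalE := isGalois_of_isSplittingField (f * (∏ c ∈ s, specialize f c).map (C : ℤ →+* ℤ[X]))
    (overRatFunc (f * (∏ c ∈ s, specialize f c).map (C : ℤ →+* ℤ[X]))).SplittingField
  have hgalR := isGalois_of_isSplittingField f (overRatFunc f).SplittingField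
  have hR : genericOrder f = Module.finrank (RatFunc ℚ) (overRatFunc f).SplittingField :=
    IsGalois.card_aut_eq_finrank _ _
  rw [← hR, ← IsGalois.card_aut_eq_finrank (RatFunc ℚ)
      (overRatFunc (f * (∏ c ∈ s, specialize f c).map (C : ℤ →+* ℤ[X]))).SplittingField, ← hcard,
    IsGalois.card_aut_eq_finrank, specialize_mul_map_C] at hle
  rw [specializationCompositum, specializationCompositum, Finset.prod_insert hk]
  exact hle

/-- The degree of a compositum is at most the product of the degrees, and each K_c has degree at
most |G|. If the total reaches |G|^card, every intermediate inequality is an equality. -/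
theorem finrank_eq_and_linearDisjoint_erase (hf : f.Monic) {s : Finset ℤ}
    (hs : genericOrder f ^ s.card ≤ Module.finrank ℚ (specializationCompositum f s)) {c : ℤ}
    (hc : c ∈ s) :
    Module.finrank ℚ (splittingFieldRat (specialize f c)) = genericOrder f ∧
      (splittingFieldRat (specialize f c)).LinearDisjoint
        (specializationCompositum f (s.erase c)) := by
  have h1 : specializationCompositum f s =
      splittingFieldRat (specialize f c) ⊔ specializationCompositum f (s.erase c) := by
    rw [← specializationCompositum_insert hf (Finset.notMem_erase c s), Finset.insert_erase hc]
  have h2 := finrank_splittingFieldRat_le hf c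
  have h3 := finrank_specializationCompositum_le hf (s.erase c)
  have h4 := IntermediateField.finrank_sup_le (splittingFieldRat (specialize f c))
    (specializationCompositum f (s.erase c))
  have h5 : genericOrder f ^ s.card = genericOrder f * genericOrder f ^ (s.erase c).card := by
    rw [← pow_succ', Finset.card_erase_add_one hc]
  rw [h1, h5] at hs
  have hpos : 0 < genericOrder f := lt_of_lt_of_le Module.finrank_pos h2
  refine ⟨le_antisymm h2 ?_, IntermediateField.LinearDisjoint.of_finrank_sup ?_⟩
  · exact Nat.le_of_mul_le_mul_right ((hs.trans h4).trans (Nat.mul_le_mul_left _ h3))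
      (pow_pos hpos _)
  · exact le_antisymm h4 ((Nat.mul_le_mul h2 h3).trans hs)

/-- Linear disjointness from a directed union can be checked on its members. -/
theorem linearDisjoint_iSup_of_monotone {k Ω : Type*} [Field k] [Field Ω] [Algebra k Ω]
    [Algebra.IsAlgebraic k Ω] (A : IntermediateField k Ω) (B : ℕ → IntermediateField k Ω)
    (hB : Monotone B) (h : ∀ n, A.LinearDisjoint (B n)) :
    A.LinearDisjoint (⨆ n, B n : IntermediateField k Ω) := by
  rw [IntermediateField.linearDisjoint_iff']
  have : Algebra.IsIntegral k (⨆ n, B n : IntermediateField k Ω).toSubalgebra :=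
    (inferInstance : Algebra.IsIntegral k (⨆ n, B n : IntermediateField k Ω))
  -- Only finite subalgebras matter, and the finitely many generators of such a subalgebra all lie
  -- in a single B n.
  refine Subalgebra.LinearDisjoint.of_linearDisjoint_finite_right _ _ fun B' hB' hfin => ?_
  obtain ⟨t, ht⟩ := (Subalgebra.fg_def.mp (Subalgebra.fg_of_fg_toSubmodule
    (Module.Finite.iff_fg.mp hfin)))
  obtain ⟨n, hn⟩ : ∃ n, B' ≤ (B n).toSubalgebra := by
    have hmem : ∀ x ∈ t, ∃ n, x ∈ B n := by
      intro x hx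
      have : x ∈ (⨆ n, B n : IntermediateField k Ω) := hB' (ht.2 ▸ Algebra.subset_adjoin hx)
      rw [← SetLike.mem_coe, IntermediateField.coe_iSup_of_directed hB.directed_le] at this
      exact Set.mem_iUnion.mp this
    choose! N hN using hmem
    obtain ⟨n, hn⟩ := (ht.1.image N).bddAbove
    refine ⟨n, ?_⟩
    rw [← ht.2]
    exact Algebra.adjoin_le fun x hx => hB (hn (Set.mem_image_of_mem N hx)) (hN x hx)
  exact (IntermediateField.linearDisjoint_iff'.mp (h n)).of_le_right_of_flat hn

theorem exists_linearlyDisjoint_specializations (hf : f.Monic)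
    (hreg : IsRegularOverRat (overRatFunc f).SplittingField) (a b : ℤ) (hb : b ≠ 0) :
    ∃ S : Set ℤ, S.Infinite ∧ (∀ c ∈ S, ∃ k : ℤ, c = a + b * k) ∧
      (∀ c ∈ S, Nonempty ((splittingFieldRat (specialize f c) ≃ₐ[ℚ]
        splittingFieldRat (specialize f c)) ≃* (overRatFunc f).Gal)) ∧
      LinearlyDisjointFamily (fun c => splittingFieldRat (specialize f c)) S := by
  choose k hk hkf using exists_specialization_finrank_ge hf hreg a b hb
  -- Greedy construction: each step adjoins a new member of the progression that multiplies the
  -- degree of the compositum by at least |G|.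
  obtain ⟨s, hs0, hs⟩ : ∃ s : ℕ → Finset ℤ, s 0 = ∅ ∧
      ∀ n, s (n + 1) = insert (a + b * k (s n)) (s n) :=
    ⟨fun n => Nat.rec ∅ (fun _ t => insert (a + b * k t) t) n, rfl, fun _ => rfl⟩
  have hmono : Monotone s := monotone_nat_of_le_succ fun n => by
    rw [hs]; exact Finset.subset_insert _ _
  have hcard : ∀ n, (s n).card = n := by
    intro n
    induction n with
    | zero => rw [hs0, Finset.card_empty]
    | succ n ih => rw [hs, Finset.card_insert_of_notMem (hk _), ih]
  have hrank : ∀ n, genericOrder f ^ (s n).card ≤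
      Module.finrank ℚ (specializationCompositum f (s n)) := by
    intro n
    induction n with
    | zero =>
      rw [hcard, pow_zero]
      exact Module.finrank_pos (R := ℚ) (M := ↥(specializationCompositum f (s 0)))
    | succ n ih =>
      rw [hs, Finset.card_insert_of_notMem (hk _), pow_succ']
      exact (Nat.mul_le_mul_left _ ih).trans (hkf (s n))
  have hAP : ∀ n, ∀ c ∈ s n, ∃ k : ℤ, c = a + b * k := by
    intro n
    induction n with
    | zero => intro c hc; rw [hs0] at hc; exact absurd hc (Finset.notMem_empty c)
    | succ n ih =>
      intro c hc
      rw [hs, Finset.mem_insert] at hc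
      rcases hc with rfl | hc
      · exact ⟨_, rfl⟩
      · exact ih c hc
  refine ⟨⋃ n : ℕ, ((s n : Finset ℤ) : Set ℤ), ?_, ?_, ?_, ?_⟩
  · intro hfin
    have h1 : ((s (hfin.toFinset.card + 1)) : Set ℤ) ⊆ ⋃ n, (s n : Set ℤ) :=
      Set.subset_iUnion (fun n => (s n : Set ℤ)) _
    have h2 : s (hfin.toFinset.card + 1) ⊆ hfin.toFinset := fun x hx =>
      hfin.mem_toFinset.mpr (h1 hx)
    have := Finset.card_le_card h2
    rw [hcard] at this
    omega
  · intro c hc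
    obtain ⟨n, hn⟩ := Set.mem_iUnion.mp hc
    exact hAP n c hn
  · intro c hc
    obtain ⟨n, hn⟩ := Set.mem_iUnion.mp hc
    refine (card_gal_specialize_le (E := (overRatFunc f).SplittingField) hf c).2 ?_
    rw [IsGalois.card_aut_eq_finrank]
    exact (finrank_eq_and_linearDisjoint_erase hf (hrank n) hn).1
  · intro c hc
    obtain ⟨n₀, hn₀⟩ := Set.mem_iUnion.mp hc
    have hdis : (splittingFieldRat (specialize f c)).LinearDisjoint
        (⨆ n, specializationCompositum f ((s n).erase c) :
          IntermediateField ℚ (AlgebraicClosure ℚ)) := by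
      refine linearDisjoint_iSup_of_monotone _ _ (fun m n hmn => specializationCompositum_mono hf
        (Finset.erase_subset_erase c (hmono hmn))) fun n => ?_
      have h1 := (finrank_eq_and_linearDisjoint_erase hf (hrank (max n n₀))
        (hmono (le_max_right n n₀) hn₀)).2
      exact h1.of_le_right (specializationCompositum_mono hf
        (Finset.erase_subset_erase c (hmono (le_max_left n n₀))))
    refine hdis.of_le_right (iSup₂_le fun c' hc' => ?_)
    obtain ⟨n, hn⟩ := Set.mem_iUnion.mp hc'.1
    exact (splittingFieldRat_le_specializationCompositum hf
      (Finset.mem_erase.mpr ⟨hc'.2, hn⟩)).trans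
      (le_iSup (fun n => specializationCompositum f ((s n).erase c)) n)

end Family

/-! ### Inertia groups of exponent two -/

section Inertia

variable {O G : Type*} [CommRing O] [Group G] [MulSemiringAction G O] {P : Ideal O} {σ τ : G}

theorem smul_mem_pow_of_mem_inertia (hσ : σ ∈ P.inertia G) (k : ℕ) :
    ∀ x ∈ P ^ k, σ • x ∈ P ^ k := by
  have h1 : ∀ x ∈ P, σ • x ∈ P := fun x hx => by
    simpa using add_mem (hσ x) hx
  induction k with
  | zero => simp
  | succ k ih =>
    intro x hx
    rw [pow_succ] at hx ⊢
    refine Submodule.mul_induction_on hx (fun y hy z hz => ?_) (fun y z hy hz => ?_)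
    · rw [smul_mul']
      exact Ideal.mul_mem_mul (ih y hy) (h1 z hz)
    · rw [smul_add]
      exact add_mem hy hz

/-- An inertia element that acts trivially on `P / P ^ 2` acts trivially on every quotient
`P ^ k / P ^ (k + 1)`. -/
theorem smul_sub_mem_pow_succ (hσ : σ ∈ P.inertia G) (h : ∀ x ∈ P, σ • x - x ∈ P ^ 2) (k : ℕ) :
    ∀ x ∈ P ^ k, σ • x - x ∈ P ^ (k + 1) := by
  induction k with
  | zero => intro x _; simpa using hσ x
  | succ k ih =>
    intro x hx
    rw [pow_succ] at hx
    refine Submodule.mul_induction_on hx (fun y hy z hz => ?_) (fun y z hy hz => ?_)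
    · have h1 : σ • (y * z) - y * z = σ • y * (σ • z - z) + (σ • y - y) * z := by
        rw [smul_mul']; ring
      rw [h1]
      refine add_mem ?_ ?_
      · have := Ideal.mul_mem_mul (smul_mem_pow_of_mem_inertia hσ k y hy) (h z hz)
        rwa [← pow_add] at this
      · have := Ideal.mul_mem_mul (ih y hy) hz
        rwa [← pow_succ] at this
    · have h1 : σ • (y + z) - (y + z) = (σ • y - y) + (σ • z - z) := by
        rw [smul_add]; ring
      rw [h1]
      exact add_mem hy hz

variable [IsDedekindDomain O] [P.IsPrime]

/-- P is generated by π modulo P², and inertia is trivial on O/P, so the action on P/P² is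
determined by the image of π. -/
theorem smul_sub_mem_sq_of_mem_inertia (hP : P ≠ ⊥) (hσ : σ ∈ P.inertia G) {π : O} (hπ : π ∈ P)
    (hπ2 : π ∉ P ^ 2) (h : σ • π - π ∈ P ^ 2) : ∀ x ∈ P, σ • x - x ∈ P ^ 2 := by
  intro x hx
  obtain ⟨d, e, he, rfl⟩ := Ideal.exists_mul_add_mem_pow_succ (i := 1) hP π x (by simpa using hπ)
    hπ2 (by simpa using hx)
  have h1 : σ • (π * d + e) - (π * d + e) =
      σ • π * (σ • d - d) + (σ • π - π) * d + (σ • e - e) := by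
    rw [smul_add, smul_mul']; ring
  rw [h1]
  refine add_mem (add_mem ?_ (Ideal.mul_mem_right _ _ h))
    (sub_mem (smul_mem_pow_of_mem_inertia hσ 2 e he) he)
  rw [pow_two]
  exact Ideal.mul_mem_mul (by simpa using smul_mem_pow_of_mem_inertia hσ 1 π (by simpa using hπ))
    (hσ d)

/-- At a prime of residue characteristic different from two, an inertia element of order at most
two is determined by its action on a uniformizer. -/
theorem eq_one_of_mem_inertia_of_sq_eq_one [FaithfulSMul G O] (hP : P ≠ ⊥) (h2 : (2 : O) ∉ P)
    (hσ : σ ∈ P.inertia G) (hσ2 : σ * σ = 1) {π : O} (hπ : π ∈ P) (hπ2 : π ∉ P ^ 2)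
    (h : σ • π - π ∈ P ^ 2) : σ = 1 := by
  have hk := smul_sub_mem_pow_succ hσ (smul_sub_mem_sq_of_mem_inertia hP hσ hπ hπ2 h)
  refine FaithfulSMul.eq_of_smul_eq_smul (α := O) fun x => ?_
  -- The element y = σx - x is negated by σ. If y is in P^k then σy - y = -2y is in P^(k+1), hence y
  -- is too since 2 is not in P; Krull's intersection theorem gives y = 0.
  have hy : σ • (σ • x - x) = -(σ • x - x) := by
    rw [smul_sub, smul_smul, hσ2, one_smul]; ring
  have hmem : ∀ k, σ • x - x ∈ P ^ k := by
    intro k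
    induction k with
    | zero => simp
    | succ k ih =>
      have h3 := hk k _ ih
      rw [hy] at h3
      have h4 : 2 * (σ • x - x) ∈ P ^ (k + 1) := by
        have := neg_mem h3
        convert this using 1
        ring
      exact (Ideal.IsPrime.mul_mem_pow P h4).resolve_left h2
  have h5 : σ • x - x ∈ ⨅ k : ℕ, P ^ k := Submodule.mem_iInf _ |>.mpr hmem
  rw [Ideal.iInf_pow_eq_bot_of_isDomain P (Ideal.IsPrime.ne_top ‹_›)] at h5
  rw [one_smul]
  exact sub_eq_zero.mp h5

/-- Write σπ ≡ dπ modulo P². As σ fixes d modulo P, the relation σ² = 1 gives d² ≡ 1 modulo P, and P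
is prime, so d ≡ ±1. -/
theorem smul_sub_mem_or_smul_add_mem (hP : P ≠ ⊥)
    (hσ : σ ∈ P.inertia G) (hσ2 : σ * σ = 1) {π : O} (hπ : π ∈ P) (hπ2 : π ∉ P ^ 2) :
    σ • π - π ∈ P ^ 2 ∨ σ • π + π ∈ P ^ 2 := by
  have hσπ : σ • π ∈ P := by
    simpa using smul_mem_pow_of_mem_inertia hσ 1 π (by simpa using hπ)
  obtain ⟨d, e, he, hd⟩ := Ideal.exists_mul_add_mem_pow_succ (i := 1) hP π (σ • π)
    (by simpa using hπ) hπ2 (by simpa using hσπ)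
  have hσe := smul_mem_pow_of_mem_inertia hσ 2 e he
  have h1 : π * (d ^ 2 - 1) ∈ P ^ 2 := by
    have h2 : σ • (π * d + e) = π := by rw [hd, smul_smul, hσ2, one_smul]
    rw [smul_add, smul_mul'] at h2
    have h3 : π * (d ^ 2 - 1) = -(σ • π * (σ • d - d)) - σ • e - e * d := by
      linear_combination d * hd + h2
    rw [h3]
    refine sub_mem (sub_mem (neg_mem ?_) hσe) (Ideal.mul_mem_right _ _ he)
    rw [pow_two]
    exact Ideal.mul_mem_mul hσπ (hσ d)
  have h4 : d ^ 2 - 1 ∈ P :=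
    Ideal.mem_prime_of_mul_mem_pow (i := 1) hP (by simpa using hπ2) (by simpa using h1)
  have h5 : (d - 1) * (d + 1) ∈ P := by convert h4 using 1; ring
  rcases Ideal.IsPrime.mem_or_mem ‹_› h5 with h | h
  · left
    have : σ • π - π = π * (d - 1) + e := by rw [← hd]; ring
    rw [this, pow_two]
    exact add_mem (Ideal.mul_mem_mul hπ h) (by simpa [pow_two] using he)
  · right
    have : σ • π + π = π * (d + 1) + e := by rw [← hd]; ring
    rw [this, pow_two]
    exact add_mem (Ideal.mul_mem_mul hπ h) (by simpa [pow_two] using he)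

/-- At a prime of residue characteristic different from two, an inertia group of exponent two has
order at most two. -/
theorem card_inertia_le_two [FaithfulSMul G O] (hP : P ≠ ⊥) (h2 : (2 : O) ∉ P)
    (h : ∀ σ ∈ P.inertia G, σ * σ = 1) : Nat.card (P.inertia G) ≤ 2 := by
  obtain ⟨π, hπ, hπ2⟩ : ∃ π ∈ P, π ∉ P ^ 2 := by
    obtain ⟨π, hπ, hπ2⟩ := Ideal.exists_mem_pow_notMem_pow_succ P hP (Ideal.IsPrime.ne_top ‹_›) 1
    exact ⟨π, by simpa using hπ, hπ2⟩
  -- Two nontrivial elements both act on π as -1, so their product acts as +1 and is trivial.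
  have key : ∀ σ τ : P.inertia G, σ ≠ 1 → τ ≠ 1 → σ = τ := by
    have hneg : ∀ σ ∈ P.inertia G, σ ≠ 1 → σ • π + π ∈ P ^ 2 := fun σ hσ hne =>
      (smul_sub_mem_or_smul_add_mem hP hσ (h σ hσ) hπ hπ2).resolve_left fun hc =>
        hne (eq_one_of_mem_inertia_of_sq_eq_one hP h2 hσ (h σ hσ) hπ hπ2 hc)
    rintro ⟨σ, hσ⟩ ⟨τ, hτ⟩ hσ1 hτ1
    have hs := hneg σ hσ (fun hc => hσ1 (Subtype.ext hc))
    have ht := hneg τ hτ (fun hc => hτ1 (Subtype.ext hc))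
    have hst : (σ * τ) • π - π ∈ P ^ 2 := by
      have h1 : (σ * τ) • π - π = σ • (τ • π + π) - (σ • π + π) := by
        rw [smul_add, smul_smul]; ring
      rw [h1]
      exact sub_mem (smul_mem_pow_of_mem_inertia hσ 2 _ ht) hs
    have h1 := eq_one_of_mem_inertia_of_sq_eq_one hP h2 (mul_mem hσ hτ) (h _ (mul_mem hσ hτ))
      hπ hπ2 hst
    refine Subtype.ext ?_
    exact mul_right_cancel (h1.trans (h τ hτ).symm)
  classical
  have hinj : Function.Injective (fun σ : P.inertia G => decide (σ = 1)) := by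
    intro σ τ hst
    by_cases hσ : σ = 1 <;> by_cases hτ : τ = 1
    · rw [hσ, hτ]
    · simp [hσ, hτ] at hst
    · simp [hσ, hτ] at hst
    · exact key σ τ hσ hτ
  simpa using Nat.card_le_card_of_injective _ hinj

end Inertia

/-! ### Discriminants and congruent roots -/

section Discriminant

theorem resultant_derivative_of_monic {R : Type*} [CommRing R] {f : R[X]} (hf : f.Monic)
    (h0 : 0 < f.natDegree) : f.resultant (derivative f) f.natDegree (f.natDegree - 1) =
      (-1) ^ (f.natDegree * (f.natDegree - 1) / 2) * f.discr := by
  rw [resultant_deriv (natDegree_pos_iff_degree_pos.mp h0), hf.leadingCoeff, mul_one]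

/-- The resultant is taken in the formal degrees n and n - 1, so it commutes with φ even when the
derivative loses degree under φ. -/
theorem discr_map_of_monic {R S : Type*} [CommRing R] [CommRing S] [Nontrivial S] (φ : R →+* S)
    {f : R[X]} (hf : f.Monic) (h0 : 0 < f.natDegree) : (f.map φ).discr = φ f.discr := by
  have h1 := resultant_derivative_of_monic hf h0
  have h2 := resultant_derivative_of_monic (hf.map φ) (by rwa [hf.natDegree_map])
  rw [hf.natDegree_map, derivative_map, resultant_map_map, h1, map_mul, map_pow, map_neg,
    map_one] at h2
  exact ((IsUnit.neg isUnit_one).pow _).mul_left_cancel h2.symm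

/-- Up to sign the discriminant is a combination of f and f', by the Bézout identity for the
resultant. -/
theorem discr_mem_of_double_root {R : Type*} [CommRing R] {f : R[X]} (hf : f.Monic)
    (h0 : 0 < f.natDegree) (I : Ideal R) (a : R) (h1 : f.eval a ∈ I)
    (h2 : (derivative f).eval a ∈ I) : f.discr ∈ I := by
  obtain ⟨p, q, -, -, hpq⟩ := exists_mul_add_mul_eq_C_resultant f (derivative f) le_rfl
    (natDegree_derivative_le f) (Or.inl h0.ne')
  have h3 := congrArg (eval a) hpq
  rw [resultant_derivative_of_monic hf h0, eval_C, eval_add, eval_mul, eval_mul] at h3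
  have h4 : (-1) ^ (f.natDegree * (f.natDegree - 1) / 2) * f.discr ∈ I := by
    rw [← h3]
    exact add_mem (Ideal.mul_mem_right _ _ h1) (Ideal.mul_mem_right _ _ h2)
  exact (Ideal.unit_mul_mem_iff_mem I ((IsUnit.neg isUnit_one).pow _)).mp h4

theorem exists_factorization_of_two_roots {O : Type*} [CommRing O] [IsDomain O] {g : O[X]}
    {α β : O} (hα : g.eval α = 0) (hβ : g.eval β = 0) (hne : β ≠ α) :
    ∃ s, g = (X - C α) * ((X - C β) * s) := by
  obtain ⟨r, rfl⟩ := dvd_iff_isRoot.mpr hα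
  have h1 : r.eval β = 0 := by
    simpa [sub_eq_zero, hne] using hβ
  obtain ⟨s, rfl⟩ := dvd_iff_isRoot.mpr h1
  exact ⟨s, rfl⟩

theorem discr_mem_of_two_roots {O : Type*} [CommRing O] [IsDomain O] {I : Ideal O} {g : O[X]}
    (hg : g.Monic) (h0 : 0 < g.natDegree) {α β : O} (hα : g.eval α = 0) (hβ : g.eval β = 0)
    (hne : β ≠ α) (hβα : β - α ∈ I) : g.discr ∈ I := by
  obtain ⟨s, hs⟩ := exists_factorization_of_two_roots hα hβ hne
  refine discr_mem_of_double_root hg h0 I α (by rw [hα]; exact zero_mem _) ?_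
  have h1 : (derivative g).eval α = (β - α) * (-s.eval α) := by
    rw [hs]; simp; ring
  rw [h1]
  exact Ideal.mul_mem_right _ _ hβα

/-- Since the roots are distinct in a domain, g = (X - α)(X - β)(X - γ) r exactly; each term of
g'(α) and g''(α) then contains β - α or γ - α. -/
theorem derivative_mem_of_three_roots {O : Type*} [CommRing O] [IsDomain O] {I : Ideal O}
    {g : O[X]} {α β γ : O} (hα : g.eval α = 0) (hβ : g.eval β = 0) (hγ : g.eval γ = 0)
    (hne : β ≠ α) (hne' : γ ≠ α) (hne'' : γ ≠ β) (hβα : β - α ∈ I) (hγα : γ - α ∈ I) :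
    (derivative g).eval α ∈ I ∧ (derivative (derivative g)).eval α ∈ I := by
  obtain ⟨s, hs⟩ := exists_factorization_of_two_roots hα hβ hne
  have h1 : s.eval γ = 0 := by
    simpa [hs, sub_eq_zero, hne', hne''] using hγ
  obtain ⟨r, rfl⟩ := dvd_iff_isRoot.mpr h1
  constructor
  · have h2 : (derivative g).eval α = (β - α) * ((γ - α) * r.eval α) := by
      rw [hs]; simp; ring
    rw [h2]
    exact Ideal.mul_mem_right _ _ hβα
  · have h2 : (derivative (derivative g)).eval α = (β - α) * (-(2 * r.eval α) +
        2 * ((γ - α) * (derivative r).eval α)) + (γ - α) * (-(2 * r.eval α)) := by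
      rw [hs]; simp; ring
    rw [h2]
    exact add_mem (Ideal.mul_mem_right _ _ hβα) (Ideal.mul_mem_right _ _ hγα)

/-- A triple root of `g` modulo a prime not dividing `n` yields a double root of the polynomial
`h` with `h(n x) = n ^ m g'(x)`. -/
theorem discr_mem_of_three_roots {O : Type*} [CommRing O] [IsDomain O] {I : Ideal O} [I.IsPrime]
    {g h : O[X]} (hh : h.Monic) (h0 : 0 < h.natDegree) {n : O} {m : ℕ} (hn : n ∉ I)
    (hcomp : h.comp (C n * X) = C (n ^ m) * derivative g) {α β γ : O} (hα : g.eval α = 0)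
    (hβ : g.eval β = 0) (hγ : g.eval γ = 0) (hne : β ≠ α) (hne' : γ ≠ α) (hne'' : γ ≠ β)
    (hβα : β - α ∈ I) (hγα : γ - α ∈ I) : h.discr ∈ I := by
  obtain ⟨h1, h2⟩ := derivative_mem_of_three_roots hα hβ hγ hne hne' hne'' hβα hγα
  have h3 := congrArg (eval α) hcomp
  have h4 := congrArg (fun p => eval α (derivative p)) hcomp
  simp only [eval_comp, eval_mul, eval_C, eval_X, derivative_comp, derivative_mul, derivative_C,
    derivative_X, zero_mul, zero_add, mul_one] at h3 h4
  -- The double root is nα: h(nα) = n^m g'(α) and n h'(nα) = n^m g''(α), where the factor n on the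
  -- left may be cancelled modulo I.
  refine discr_mem_of_double_root hh h0 I (n * α) ?_ ?_
  · rw [h3]
    exact Ideal.mul_mem_left _ _ h1
  · refine (Ideal.IsPrime.mem_or_mem ‹_› (?_ : n * _ ∈ I)).resolve_left hn
    rw [h4]
    exact Ideal.mul_mem_left _ _ h2

end Discriminant

section Specialization

theorem discr_specialize {h : ℤ[X][X]} (hh : h.Monic) (h0 : 0 < h.natDegree) (c : ℤ) :
    (specialize h c).discr = h.discr.eval c :=
  discr_map_of_monic (evalRingHom c) hh h0

theorem specialize_normalizedDerivative_comp {f : ℤ[X][X]} {n : ℕ} (hn : 2 < n) (hf : f.Monic)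
    (hd : f.natDegree = n) (c : ℤ) :
    (specialize (normalizedDerivative f) c).comp (C (n : ℤ) * X) =
      C ((n : ℤ) ^ (n - 2)) * derivative (specialize f c) := by
  have h1 := congrArg (Polynomial.map (evalRingHom c)) (normalizedDerivative_comp f n hn hf hd)
  rw [Polynomial.map_comp] at h1
  rw [derivative_specialize]
  simpa [specialize] using h1

theorem natDegree_normalizedDerivative (f : ℤ[X][X]) :
    (normalizedDerivative f).natDegree = f.natDegree - 1 := by
  rw [normalizedDerivative, natDegree_integralNormalization, natDegree_derivative]

theorem monic_normalizedDerivative {f : ℤ[X][X]} (hd : 0 < f.natDegree) :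
    (normalizedDerivative f).Monic :=
  monic_integralNormalization fun h => by
    rw [derivative_eq_zero] at h
    rw [h] at hd
    simp at hd

theorem discr_ne_zero_of_separable {f : ℤ[X][X]} (hf : f.Monic) (h0 : 0 < f.natDegree)
    (hsep : (overRatFunc f).Separable) : f.discr ≠ 0 := by
  intro h
  have h1 := resultant_derivative_of_monic hf h0
  rw [h, mul_zero] at h1
  have h2 := resultant_ne_zero _ _ hsep
  apply h2
  have h3 : (overRatFunc f) = f.map ((algebraMap ℚ[X] (RatFunc ℚ)).comp
      (mapRingHom (Int.castRingHom ℚ))) := by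
    rw [overRatFunc, overRat, map_map]
  rw [h3, derivative_map, resultant_map_map, natDegree_map_eq_of_injective,
    natDegree_map_eq_of_injective, natDegree_derivative, h1, map_zero]
  all_goals
    rw [RingHom.coe_comp]
    exact (IsFractionRing.injective ℚ[X] (RatFunc ℚ)).comp
      (map_injective _ Int.cast_injective)

end Specialization

/-! ### Choice of the arithmetic progression -/

section Bezout

/-- If every common divisor of two integer polynomials divides a nonzero constant, then some
nonzero integer is a combination of the two polynomials. -/
theorem exists_combination_eq_C {A B : ℤ[X]} (hA : A ≠ 0) {N : ℤ} (hN : N ≠ 0)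
    (h : ∀ e : ℤ[X], e ∣ A → e ∣ B → e ∣ C N) :
    ∃ M : ℤ, M ≠ 0 ∧ ∃ u v : ℤ[X], u * A + v * B = C M := by
  have hinj : Function.Injective (Polynomial.map (Int.castRingHom ℚ)) :=
    map_injective _ Int.cast_injective
  have hcop : IsCoprime (A.map (Int.castRingHom ℚ)) (B.map (Int.castRingHom ℚ)) := by
    classical
    rw [← EuclideanDomain.gcd_isUnit_iff]
    generalize hr : EuclideanDomain.gcd (A.map (Int.castRingHom ℚ)) (B.map (Int.castRingHom ℚ)) = r
    have hrA : r ∣ A.map (Int.castRingHom ℚ) := hr ▸ EuclideanDomain.gcd_dvd_left _ _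
    have hrB : r ∣ B.map (Int.castRingHom ℚ) := hr ▸ EuclideanDomain.gcd_dvd_right _ _
    have hr0 : r ≠ 0 := ne_zero_of_dvd_ne_zero
      (fun hc => hA (hinj (by rw [hc, Polynomial.map_zero]))) hrA
    -- Gauss's lemma: the primitive part of the rational gcd divides A and B over ℤ, hence divides
    -- the constant N, so it is a primitive constant and therefore a unit.
    refine isUnit_or_eq_zero_of_isUnit_integerNormalization_primPart (R := ℤ) hr0 ?_
    obtain ⟨b, hb, hbe⟩ := IsLocalization.integerNormalization_spec (nonZeroDivisors ℤ) r
    generalize IsLocalization.integerNormalization (nonZeroDivisors ℤ) r = s at hbe ⊢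
    have hb0 : (b : ℚ) ≠ 0 := Int.cast_ne_zero.mpr (nonZeroDivisors.ne_zero hb)
    have hs : s.primPart.map (Int.castRingHom ℚ) ∣ r := by
      have h1 : s.primPart.map (Int.castRingHom ℚ) ∣ b • r := by
        rw [← hbe]
        exact Polynomial.map_dvd _ s.primPart_dvd
      have h2 : r = C ((b : ℚ)⁻¹) * (b • r) := by
        rw [zsmul_eq_mul, ← mul_assoc, ← C_eq_intCast, ← C_mul, inv_mul_cancel₀ hb0, C_1, one_mul]
      rw [h2]
      exact h1.mul_left _
    have hprim := s.isPrimitive_primPart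
    have hN' : s.primPart ∣ C N := h _
      ((IsPrimitive.Int.dvd_iff_map_cast_dvd_map_cast _ _ hprim).mpr (hs.trans hrA))
      ((IsPrimitive.Int.dvd_iff_map_cast_dvd_map_cast _ _ hprim).mpr (hs.trans hrB))
    have hd := natDegree_le_of_dvd hN' (C_ne_zero.mpr hN)
    rw [natDegree_C, Nat.le_zero] at hd
    rw [eq_C_of_natDegree_eq_zero hd] at hprim ⊢
    exact isUnit_C.mpr (isPrimitive_iff_isUnit_of_C_dvd.mp hprim _ dvd_rfl)
  obtain ⟨u, v, huv⟩ := hcop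
  obtain ⟨b, hb, hbu⟩ := IsLocalization.integerNormalization_spec (nonZeroDivisors ℤ) u
  obtain ⟨d, hd, hdv⟩ := IsLocalization.integerNormalization_spec (nonZeroDivisors ℤ) v
  refine ⟨b * d, mul_ne_zero (nonZeroDivisors.ne_zero hb) (nonZeroDivisors.ne_zero hd),
    C d * IsLocalization.integerNormalization (nonZeroDivisors ℤ) u,
    C b * IsLocalization.integerNormalization (nonZeroDivisors ℤ) v, hinj ?_⟩
  rw [algebraMap_int_eq] at hbu hdv
  simp only [Polynomial.map_add, Polynomial.map_mul, Polynomial.map_C, hbu, hdv, zsmul_eq_mul,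
    ← C_eq_intCast, C_mul, Int.coe_castRingHom]
  linear_combination C (b : ℚ) * C (d : ℚ) * huv

/-- On the residue class of `c₀` modulo a suitable nonzero integer, a prime dividing the values of
both polynomials divides `N`, provided this holds at `c₀`. -/
theorem exists_progression_forall_prime_dvd {A B : ℤ[X]} (hA : A ≠ 0) {N : ℤ}
    (h : IsGCDOf (C N) A B) (c₀ : ℤ)
    (hc₀ : ∀ p : ℕ, p.Prime → (p : ℤ) ∣ A.eval c₀ → (p : ℤ) ∣ B.eval c₀ → (p : ℤ) ∣ N) :
    ∃ M : ℤ, M ≠ 0 ∧ ∀ k : ℤ, ∀ p : ℕ, p.Prime → (p : ℤ) ∣ A.eval (c₀ + M * k) →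
      (p : ℤ) ∣ B.eval (c₀ + M * k) → (p : ℤ) ∣ N := by
  have hN : N ≠ 0 := by
    rintro rfl
    rw [C_0] at h
    exact hA (zero_dvd_iff.mp h.1)
  obtain ⟨M, hM, u, v, huv⟩ := exists_combination_eq_C hA hN h.2.2
  refine ⟨M, hM, fun k p hp hpA hpB => ?_⟩
  have h1 := congrArg (eval (c₀ + M * k)) huv
  rw [eval_add, eval_mul, eval_mul, eval_C] at h1
  -- A common prime divisor of the two values divides M, so c₀ + M k ≡ c₀ modulo p and divisibility
  -- passes to c₀.
  have hpM : (p : ℤ) ∣ M := h1 ▸ dvd_add (hpA.mul_left _) (hpB.mul_left _)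
  have h2 : ∀ q : ℤ[X], (p : ℤ) ∣ q.eval (c₀ + M * k) → (p : ℤ) ∣ q.eval c₀ := by
    intro q hq
    have h3 : (p : ℤ) ∣ q.eval (c₀ + M * k) - q.eval c₀ :=
      (by simpa using hpM.mul_right k : (p : ℤ) ∣ c₀ + M * k - c₀).trans (sub_dvd_eval_sub _ _ q)
    simpa using dvd_sub hq h3
  exact hc₀ p hp (h2 A hpA) (h2 B hpB)

end Bezout

/-! ### Inertia in the splitting fields over ℚ -/

section SplittingFieldInertia

open NumberField

instance numberField_splittingFieldRat (g : ℤ[X]) : NumberField (splittingFieldRat g) where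
  to_finiteDimensional := finiteDimensional_splittingFieldRat g

theorem faithfulSMul_ringOfIntegers (K : Type*) [Field K] [NumberField K] :
    FaithfulSMul (K ≃ₐ[ℚ] K) (𝓞 K) where
  eq_of_smul_eq_smul {σ τ} h := by
    refine AlgEquiv.ext fun x => ?_
    obtain ⟨a, b, hb, rfl⟩ := IsFractionRing.div_surjective (A := 𝓞 K) x
    have h1 : ∀ z : 𝓞 K, σ (algebraMap (𝓞 K) K z) = τ (algebraMap (𝓞 K) K z) := fun z =>
      congrArg (algebraMap (𝓞 K) K) (h z)
    rw [map_div₀, map_div₀, h1, h1]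

variable {g : ℤ[X]}

/-- A nontrivial automorphism of the splitting field of `g` moves a root of `g`. -/
theorem exists_root_smul_ne (hg : g.Monic)
    {σ : splittingFieldRat g ≃ₐ[ℚ] splittingFieldRat g} (hσ : σ ≠ 1) :
    ∃ α : 𝓞 (splittingFieldRat g), (g.map (Int.castRingHom _)).eval α = 0 ∧ σ • α ≠ α := by
  by_contra! hcon
  apply hσ
  have h := isSplittingField_splittingFieldRat g
  have h1 : (σ : splittingFieldRat g →ₐ[ℚ] splittingFieldRat g) = AlgHom.id ℚ _ := by
    refine AlgHom.ext_of_adjoin_eq_top (IsSplittingField.adjoin_rootSet (splittingFieldRat g)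
      (g.map (Int.castRingHom ℚ))) ?_
    intro x hx
    have hx0 : eval₂ (algebraMap ℤ (splittingFieldRat g)) x g = 0 := by
      have := aeval_eq_zero_of_mem_rootSet hx
      rw [aeval_def, eval₂_map] at this
      rwa [Subsingleton.elim (algebraMap ℤ (splittingFieldRat g))
        ((algebraMap ℚ (splittingFieldRat g)).comp (Int.castRingHom ℚ))]
    obtain ⟨a, rfl⟩ : ∃ a : 𝓞 (splittingFieldRat g), algebraMap _ (splittingFieldRat g) a = x :=
      ⟨⟨x, g, hg, hx0⟩, rfl⟩
    refine congrArg (algebraMap (𝓞 (splittingFieldRat g)) (splittingFieldRat g)) (hcon a ?_)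
    refine FaithfulSMul.algebraMap_injective (𝓞 (splittingFieldRat g)) (splittingFieldRat g) ?_
    rw [eval_map, hom_eval₂, map_zero,
      Subsingleton.elim (RingHom.comp _ _) (algebraMap ℤ (splittingFieldRat g))]
    exact hx0
  exact AlgEquiv.ext fun x => DFunLike.congr_fun h1 x

theorem eval_map_intCast_smul {O G : Type*} [CommRing O] [Group G] [MulSemiringAction G O]
    (q : ℤ[X]) (σ : G) (α : O) (h : (q.map (Int.castRingHom O)).eval α = 0) :
    (q.map (Int.castRingHom O)).eval (σ • α) = 0 := by
  have h1 := congrArg (MulSemiringAction.toRingHom G O σ) h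
  rw [eval_map, hom_eval₂, map_zero, Subsingleton.elim (RingHom.comp _ _) (Int.castRingHom O)] at h1
  rwa [eval_map]

variable {P : Ideal (𝓞 (splittingFieldRat g))} {p : ℕ}

theorem intCast_mem_iff_of_liesOver (hP : P.LiesOver (Ideal.span {(p : ℤ)})) (m : ℤ) :
    (m : 𝓞 (splittingFieldRat g)) ∈ P ↔ (p : ℤ) ∣ m := by
  rw [← Ideal.mem_span_singleton, hP.over, Ideal.under_def, Ideal.mem_comap, algebraMap_int_eq,
    eq_intCast]

/-- Primes not dividing the discriminant of `g` are unramified in the splitting field of `g`. -/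
theorem eq_one_of_mem_inertia_of_not_dvd_discr (hg : g.Monic) (h0 : 0 < g.natDegree) [P.IsPrime]
    (hP : P.LiesOver (Ideal.span {(p : ℤ)})) (hp : ¬ (p : ℤ) ∣ g.discr)
    {σ : splittingFieldRat g ≃ₐ[ℚ] splittingFieldRat g} (hσ : σ ∈ P.inertia _) : σ = 1 := by
  by_contra hne
  obtain ⟨α, hα, hσα⟩ := exists_root_smul_ne hg hne
  have h1 := discr_mem_of_two_roots (hg.map _) (by rwa [hg.natDegree_map]) hα
    (eval_map_intCast_smul g σ α hα) hσα (hσ α)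
  rw [discr_map_of_monic _ hg h0, eq_intCast, intCast_mem_iff_of_liesOver hP] at h1
  exact hp h1

/-- If `g` has no triple roots modulo `p`, then inertia groups above `p` have exponent two. -/
theorem mul_self_eq_one_of_mem_inertia_of_not_dvd_discr (hg : g.Monic) [P.IsPrime]
    (hP : P.LiesOver (Ideal.span {(p : ℤ)})) {h : ℤ[X]} (hh : h.Monic) (h0 : 0 < h.natDegree)
    {n m : ℕ} (hcomp : h.comp (C (n : ℤ) * X) = C ((n : ℤ) ^ m) * derivative g)
    (hn : ¬ (p : ℤ) ∣ n) (hp : ¬ (p : ℤ) ∣ h.discr)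
    {σ : splittingFieldRat g ≃ₐ[ℚ] splittingFieldRat g} (hσ : σ ∈ P.inertia _) : σ * σ = 1 := by
  by_contra hne
  obtain ⟨α, hα, hσα⟩ := exists_root_smul_ne hg hne
  -- The roots α, σα, σ²α are pairwise distinct and, as σ is in the inertia group, congruent modulo
  -- P: a triple root modulo P.
  have hσα1 : σ • α ≠ α := fun hc => hσα (by rw [mul_smul, hc, hc])
  have hσα2 : (σ * σ) • α ≠ σ • α := fun hc => hσα1 (smul_left_cancel σ (by rw [← mul_smul, hc]))
  have hcomp' := congrArg (Polynomial.map (Int.castRingHom (𝓞 (splittingFieldRat g)))) hcomp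
  simp only [Polynomial.map_comp, Polynomial.map_mul, Polynomial.map_C, Polynomial.map_X,
    map_pow] at hcomp'
  have h1 := discr_mem_of_three_roots (I := P) (hh.map (Int.castRingHom (𝓞 (splittingFieldRat g))))
    (by rwa [hh.natDegree_map])
    (n := Int.castRingHom (𝓞 (splittingFieldRat g)) n) (m := m)
    (by rwa [eq_intCast, intCast_mem_iff_of_liesOver hP])
    (g := g.map (Int.castRingHom (𝓞 (splittingFieldRat g))))
    (by simpa [derivative_map] using hcomp')
    hα (eval_map_intCast_smul g σ α hα) (eval_map_intCast_smul g (σ * σ) α hα) hσα1 hσα hσα2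
    (hσ α) (mul_mem hσ hσ α)
  rw [discr_map_of_monic _ hh h0, eq_intCast, intCast_mem_iff_of_liesOver hP] at h1
  exact hp h1

theorem inertiaOrderLeTwoAt_of_not_dvd_discr (hg : g.Monic) (h0 : 0 < g.natDegree)
    (hp : ¬ (p : ℤ) ∣ g.discr) : InertiaOrderLeTwoAt g p := by
  intro P hPp hP
  have : Subsingleton (P.inertia (splittingFieldRat g ≃ₐ[ℚ] splittingFieldRat g)) :=
    ⟨fun σ τ => Subtype.ext ((eq_one_of_mem_inertia_of_not_dvd_discr hg h0 hP hp σ.2).trans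
      (eq_one_of_mem_inertia_of_not_dvd_discr hg h0 hP hp τ.2).symm)⟩
  exact (Finite.card_le_one_iff_subsingleton.mpr this).trans one_le_two

theorem inertiaOrderLeTwoAt_of_not_dvd_discr_derivative (hg : g.Monic) {h : ℤ[X]} (hh : h.Monic)
    (h0 : 0 < h.natDegree) {n m : ℕ}
    (hcomp : h.comp (C (n : ℤ) * X) = C ((n : ℤ) ^ m) * derivative g) (hp : p.Prime)
    (hn : ¬ (p : ℤ) ∣ n) (hdiscr : ¬ (p : ℤ) ∣ h.discr) (hp2 : p ≠ 2) :
    InertiaOrderLeTwoAt g p := by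
  intro P hPp hP
  have hfaith := faithfulSMul_ringOfIntegers (splittingFieldRat g)
  refine card_inertia_le_two ?_ ?_ fun σ hσ =>
    mul_self_eq_one_of_mem_inertia_of_not_dvd_discr hg hP hh h0 hcomp hn hdiscr hσ
  · rintro rfl
    have h1 := (intCast_mem_iff_of_liesOver hP p).mpr dvd_rfl
    rw [Ideal.mem_bot] at h1
    exact hp.ne_zero (by exact_mod_cast h1)
  · intro h2
    have h1 := (intCast_mem_iff_of_liesOver hP 2).mp (by exact_mod_cast h2)
    exact hp2 ((Nat.prime_dvd_prime_iff_eq hp Nat.prime_two).mp (by exact_mod_cast h1))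

end SplittingFieldInertia

/-! ### Proof of the two parts -/

theorem exists_progression_inertiaOrderLeTwo {f : ℤ[X][X]} {n : ℕ} (hn : 2 < n) (hf : f.Monic)
    (hd : f.natDegree = n) (hsep : (overRatFunc f).Separable) {N : ℤ}
    (hgcd : IsGCDOf (C N) f.discr (C (((n : ℤ) - 1) * n) * (normalizedDerivative f).discr))
    (hc : ∃ c : ℤ, ∀ p : ℕ, p.Prime → (p : ℤ) ∣ (specialize f c).discr →
      (p : ℤ) ∣ ((n : ℤ) - 1) * n * (specialize (normalizedDerivative f) c).discr → (p : ℤ) ∣ N) :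
    ∃ a b : ℤ, b ≠ 0 ∧ ∀ k : ℤ, InertiaOrderLeTwoAwayFrom (specialize f (a + b * k)) N := by
  have hf0 : 0 < f.natDegree := by omega
  have hm := monic_normalizedDerivative hf0
  have hm0 : 0 < (normalizedDerivative f).natDegree := by
    rw [natDegree_normalizedDerivative]; omega
  obtain ⟨c₀, hc₀⟩ := hc
  obtain ⟨M, hM, h⟩ := exists_progression_forall_prime_dvd
    (discr_ne_zero_of_separable hf hf0 hsep) hgcd c₀ (by
      intro p hp hA hB
      rw [eval_mul, eval_C] at hB
      exact hc₀ p hp (by rwa [discr_specialize hf hf0]) (by rwa [discr_specialize hm hm0]))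
  refine ⟨c₀, M, hM, fun k p hp hpN => ?_⟩
  have hsm := specialize_monic hf (c₀ + M * k)
  by_cases hA : (p : ℤ) ∣ (specialize f (c₀ + M * k)).discr
  · have hB : ¬ (p : ℤ) ∣ ((n : ℤ) - 1) * n *
        (specialize (normalizedDerivative f) (c₀ + M * k)).discr := by
      intro hB
      rw [discr_specialize hf hf0] at hA
      rw [discr_specialize hm hm0] at hB
      exact hpN (h k p hp hA (by rwa [eval_mul, eval_C]))
    refine inertiaOrderLeTwoAt_of_not_dvd_discr_derivative hsm
      (specialize_monic hm (c₀ + M * k)) ?_ (specialize_normalizedDerivative_comp hn hf hd _) hp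
      (fun hc => hB ((hc.mul_left _).mul_right _)) (fun hc => hB (hc.mul_left _)) ?_
    · rw [specialize, hm.natDegree_map]
      exact hm0
    -- The factor n - 1 serves here: n(n - 1) is even, so p = 2 would divide the second value.
    · rintro rfl
      refine hB (Dvd.dvd.mul_right ?_ _)
      have := (Int.even_mul_pred_self n).two_dvd
      rw [mul_comm] at this
      exact_mod_cast this
  · refine inertiaOrderLeTwoAt_of_not_dvd_discr hsm ?_ hA
    rw [specialize, hf.natDegree_map]
    exact hf0

end

theorem theorem2p2 (f : ℤ[X][X]) (n : ℕ) (hn : 2 < n) (hmonic : f.Monic) (hdeg : f.natDegree = n)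
    (hsep : (overRatFunc f).Separable) :
    -- Part 1
    (∀ N : ℤ,
      IsGCDOf (C N) f.discr (C (((n : ℤ) - 1) * n) * (normalizedDerivative f).discr) →
      (∃ c : ℤ, ∀ p : ℕ, p.Prime → (p : ℤ) ∣ (specialize f c).discr →
        (p : ℤ) ∣ ((n : ℤ) - 1) * n * (specialize (normalizedDerivative f) c).discr →
        (p : ℤ) ∣ N) →
      ∃ a b : ℤ, b ≠ 0 ∧ ∀ k : ℤ,
        InertiaOrderLeTwoAwayFrom (specialize f (a + b * k)) N ∧
        (N = 1 → ∀ p : ℕ, p.Prime → InertiaOrderLeTwoAt (specialize f (a + b * k)) p)) ∧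
    -- Part 2
    (∀ N a b : ℤ, b ≠ 0 →
      (∀ k : ℤ, InertiaOrderLeTwoAwayFrom (specialize f (a + b * k)) N) →
      ∀ (G : Type*) [Group G],
      Irreducible (overRat f) →
      Nonempty ((overRatFunc f).Gal ≃* G) →
      IsRegularOverRat (overRatFunc f).SplittingField →
      ∃ S : Set ℤ, S.Infinite ∧ (∀ c ∈ S, ∃ k : ℤ, c = a + b * k) ∧
        (∀ c ∈ S, Nonempty
          ((splittingFieldRat (specialize f c) ≃ₐ[ℚ] splittingFieldRat (specialize f c)) ≃* G)) ∧
        LinearlyDisjointFamily (fun c => splittingFieldRat (specialize f c)) S ∧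
        ∀ c ∈ S, InertiaOrderLeTwoAwayFrom (specialize f c) N) := by
  refine ⟨fun N hgcd hc => ?_, fun N a b hb hI G _ _ hG hreg => ?_⟩
  · obtain ⟨a, b, hb, h⟩ := exists_progression_inertiaOrderLeTwo hn hmonic hdeg hsep hgcd hc
    refine ⟨a, b, hb, fun k => ⟨h k, ?_⟩⟩
    rintro rfl p hp
    exact h k p hp fun hc =>
      hp.one_lt.ne' (by exact_mod_cast Int.eq_one_of_dvd_one (by positivity) hc)
  · obtain ⟨S, hS, hSP, hgal, hdisj⟩ :=
      exists_linearlyDisjoint_specializations hmonic hreg a b hb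
    refine ⟨S, hS, hSP, fun c hc => ?_, hdisj, fun c hc => ?_⟩
    · obtain ⟨e⟩ := hgal c hc
      exact hG.map e.trans
    · obtain ⟨k, rfl⟩ := hSP c hc
      exact hI k
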